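/- **Theorem 8.** Let $\mathbb T^4=\mathbb R^4/\mathbb Z^4$ be the flat torus with normalized Lebesgue measure, let $(\varphi_n)_{n\in\mathbb Z^4}$, $\varphi_n(x)=\cos(2\pi n\cdot x)+\sin(2\pi n\cdot x)$, be the complete orthonormal system of real eigenfunctions of $-\Delta$ with eigenvalues $\lambda_n=4\pi^2|n|^2$, and for $s\in\mathbb R$ let $$H^s=\Big\{u=\sum_n u_n\varphi_n:\ \|u\|_{H^s}^2:=\sum_n(1+\lambda_n)^s u_n^2<\infty\Big\},\qquad \langle u,v\rangle=\sum_n u_nv_n\quad(u\in H^s,\ v\in H^{-s}).$$ Let $p_t(x,y)=\sum_n e^{-\lambda_n t}\varphi_n(x)\varphi_n(y)$ be the heat kernel, $\mathring G(x,y)=\int_0^\infty (p_t(x,y)-1)\,dt$ the grounded Green kernel, $\mathring{\mathsf G}u(x)=\int \mathring G(x,y)u(y)\,dy$ the grounded Green operator, $k(x,y)=8\pi^2\int \mathring G(x,z)\mathring G(z,y)\,dz$, and $\mathfrak k(u,v)=\sum_{n\neq 0}\frac{8\pi^2}{\lambda_n^2}u_nv_n$ for $u,v\in H^{-2}$. For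 $\ell\in\mathbb N_0$ let $I_\ell=\{0,\dots,2^\ell-1\}^4\times(\{0,1\}^4\setminus\{0\})$ and, for $\iota=(\alpha,\beta)\in I_\ell$, let $\eta_{\ell,\iota}(x)=\prod_{j=1}^4\tilde\eta_{\ell,\alpha_j,\beta_j}(x_j)$, $x\in[0,1)^4$, be the isotropic Haar functions, where $\tilde\eta_{\ell,a,0}(t)=2^{\ell/2}1_{[a,a+1)}(2^\ell t)$ and $\tilde\eta_{\ell,a,1}(t)=2^{\ell/2}\big(1_{[a,a+1/2)}-1_{[a+1/2,a+1)}\big)(2^\ell t)$. Let $(\xi_{\kappa,\iota})_{\kappa\in\mathbb N_0,\iota\in I_\kappa}$ be i.i.d. standard Gaussian random variables on a probability space $(\Omega,\mathfrak F,\mathbf P)$, and put $$\hat h_\ell=\sqrt8\,\pi\sum_{\kappa=0}^{\ell-1}\sum_{\iota\in I_\kappa}\xi_{\kappa,\iota}\,\mathring{\mathsf G}\eta_{\kappa,\iota}.$$ Then every realization of $\hat h_\ell$ is in $H^2$, and the series $$h=\sqrt8\,\pi\sum_{\kappa=0}^{\infty}\sum_{\iota\in I_\kappa}\xi_{\kappa,\iota}\,\mathring{\mathsf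 G}\eta_{\kappa,\iota}$$ defines a random distribution $h=\sum_n h_n\varphi_n$ such that, with $\langle u,h\rangle:=\sum_n u_nh_n$ (unconditionally convergent in $L^2(\mathbf P)$ for each $u\in H^{-2}$, and a.s. equal to the pathwise pairing if $u\in H^\epsilon$ for some $\epsilon>0$), the following hold. 1. $h$ is the biharmonic (co-biharmonic) Gaussian field with covariance function $k$: $(\langle u,h\rangle)_{u\in H^{-2}}$ is a linear family of centered Gaussian random variables with $\mathbf E[\langle u,h\rangle^2]=\mathfrak k(u,u)$, and $\mathbf E[\langle u,h\rangle\langle v,h\rangle]=\iint u(x)\,k(x,y)\,v(y)\,dx\,dy$, with an absolutely convergent integral, for all $u,v\in L^2(\mathbb T^4)$. 2. For every $\epsilon>0$, $\hat h_\ell\to h$ in $L^2(\mathbf P;H^{-\epsilon})$, that is, $\mathbf E\|h\|_{H^{-\epsilon}}^2<\infty$ and $\mathbf E\|\hat h_\ell-h\|_{H^{-\epsilon}}^2\to0$ as $\ell\to\infty$. In particular, almost surely $h\in H^{-\epsilon}$ for every $\epsilon>0$. 3. For every $u\in H^{-2}$, $(\langle u,\hat h_\ell\rangle)_{\ell}$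 is a centered $L^2(\mathbf P)$-bounded martingale with respect to the filtration $\sigma(\xi_{\kappa,\iota}:\kappa<\ell,\ \iota\in I_\kappa)$, and $\langle u,\hat h_\ell\rangle\to\langle u,h\rangle$ in $L^2(\mathbf P)$ as $\ell\to\infty$. -/

import Mathlib

open MeasureTheory ProbabilityTheory Filter Topology
open scoped ENNReal NNReal

noncomputable section

namespace BiharmonicTorus

/-! ### The flat torus `ℝ⁴ / ℤ⁴` and its spectral decomposition -/

/-- The flat torus `𝕋⁴ = ℝ⁴ / ℤ⁴`; its `volume` is the normalized Lebesgue (Haar) measure. -/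
abbrev T4 : Type := UnitAddTorus (Fin 4)

/-- Frequencies. -/
abbrev Freq : Type := Fin 4 → ℤ

/-- The eigenvalue `λ_n = 4π²|n|²` of `-Δ` on `ℝ⁴ / ℤ⁴`. -/
def eigenvalue (n : Freq) : ℝ := 4 * Real.pi ^ 2 * ∑ i, (n i : ℝ) ^ 2

/-- The real eigenfunction `φ_n(x) = cos (2π n·x) + sin (2π n·x)` of `-Δ` with eigenvalue `λ_n`.
The family `(φ_n)`, `n ∈ ℤ⁴`, is a complete orthonormal system of the real space `L²(𝕋⁴)`, and
`φ_0` is the constant function `1`. -/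
def eigenfunction (n : Freq) (x : T4) : ℝ :=
  (UnitAddTorus.mFourier n x).re + (UnitAddTorus.mFourier n x).im

/-- Formal real series `u = ∑ n, α_n φ_n`, given by the coefficients `α_n`. All real distributions
on the torus are of this form. -/
abbrev FormalSeries : Type := Freq → ℝ

/-- The series of a function `u`: its coefficients are `⟨u, φ_n⟩`. -/
def coeff (u : T4 → ℝ) : FormalSeries := fun n => ∫ x, u x * eigenfunction n x

/-- The squared norm `‖u‖²_{H^s} = ‖(1 - Δ)^{s/2} u‖²_{L²} = ∑ n, (1 + λ_n)^s α_n²`, with the value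
`∞` allowed. -/
def sobolevNormSq (s : ℝ) (u : FormalSeries) : ℝ≥0∞ :=
  ∑' n, ENNReal.ofReal ((1 + eigenvalue n) ^ s * u n ^ 2)

/-- The Sobolev space `H^s(𝕋⁴) = (1 - Δ)^{-s/2} L²(𝕋⁴)`, for every real `s`. -/
def Sobolev (s : ℝ) : Set FormalSeries := {u | sobolevNormSq s u < ∞}

/-- The pairing `⟨u, v⟩ = ∑ n, α_n β_n` of `u ∈ H^s` and `v ∈ H^{-s}`
(an absolutely convergent series). -/
def pairing (u v : FormalSeries) : ℝ := ∑' n, u n * v n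

/-! ### Heat kernel, Green kernel, and the kernel `k` -/

/-- The heat kernel `p_t(x, y) = ∑ n, exp (-λ_n t) φ_n(x) φ_n(y)`. -/
def heatKernel (t : ℝ) (x y : T4) : ℝ :=
  ∑' n, Real.exp (-(eigenvalue n * t)) * (eigenfunction n x * eigenfunction n y)

/-- The grounded Green kernel `G(x, y) = ∫₀^∞ (p_t(x, y) - 1) dt` (for `x ≠ y`). -/
def greenKernel (x y : T4) : ℝ := ∫ t in Set.Ioi (0 : ℝ), (heatKernel t x y - 1)

/-- The grounded Green operator, as an integral operator. -/
def greenOp (u : T4 → ℝ) (x : T4) : ℝ := ∫ y, greenKernel x y * u y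

/-- The covariance kernel `k(x, y) = 8π² ∫ G(x, z) G(z, y) dz` (for `x ≠ y`). -/
def covKernel (x y : T4) : ℝ := 8 * Real.pi ^ 2 * ∫ z, greenKernel x z * greenKernel z y

/-- The bilinear form `𝔨(u, v) = ∑_{n ≠ 0} ν_n⁻¹ ⟨u, φ_n⟩ ⟨v, φ_n⟩` on `H^{-2}(𝕋⁴)`, where
`ν_n = λ_n² / (8π²)` are the eigenvalues of the Paneitz operator `Δ² / (8π²)`. -/
def covForm (u v : FormalSeries) : ℝ :=
  ∑' n : {n : Freq // n ≠ 0},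
    (eigenvalue n.1 ^ 2 / (8 * Real.pi ^ 2))⁻¹ * (u n.1 * v n.1)

/-! ### The isotropic Haar system -/

/-- `A_ℓ = {0, …, 2^ℓ - 1}⁴`. -/
abbrev CubeIndex (l : ℕ) : Type := Fin 4 → Fin (2 ^ l)

/-- `B = {0, 1}⁴ ∖ {(0, 0, 0, 0)}`. -/
abbrev TypeIndex : Type := {b : Fin 4 → Fin 2 // b ≠ 0}

/-- `I_ℓ = A_ℓ × B`. -/
abbrev HaarIndex (l : ℕ) : Type := CubeIndex l × TypeIndex

/-- The representative in `[0, 1)` of a point of the circle `ℝ / ℤ`. -/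
def rep (x : UnitAddCircle) : ℝ := (AddCircle.equivIco (1 : ℝ) 0 x : ℝ)

/-- The one-dimensional factors of the Haar functions. -/
def haarFactor (l a : ℕ) (b : Fin 2) (t : ℝ) : ℝ :=
  if b = 0 then
    (2 : ℝ) ^ ((l : ℝ) / 2) * (Set.Ico (a : ℝ) (a + 1)).indicator 1 (2 ^ l * t)
  else
    (2 : ℝ) ^ ((l : ℝ) / 2) *
      ((Set.Ico (a : ℝ) (a + 1 / 2)).indicator 1 (2 ^ l * t) -
        (Set.Ico ((a : ℝ) + 1 / 2) (a + 1)).indicator 1 (2 ^ l * t))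

/-- The Haar function `η_{ℓ,α,β}` on the torus, `(α, β) ∈ I_ℓ`. -/
def haar (l : ℕ) (i : HaarIndex l) (x : T4) : ℝ :=
  ∏ j, haarFactor l (i.1 j) (i.2.1 j) (rep (x j))

/-! ### Random fields -/

variable {Ω : Type*} [mΩ : MeasurableSpace Ω]

/-- The semi-discrete field
`ĥ_ℓ^ω(x) = √8 π ∑_{κ < ℓ} ∑_{ι ∈ I_κ} ξ_{κ,ι}^ω (G η_{κ,ι})(x)`. -/
def hHat (ξ : (Σ κ, HaarIndex κ) → Ω → ℝ) (l : ℕ) (ω : Ω) (x : T4) : ℝ :=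
  Real.sqrt 8 * Real.pi *
    ∑ κ ∈ Finset.range l, ∑ i : HaarIndex κ, ξ ⟨κ, i⟩ ω * greenOp (haar κ i) x

/-- The filtration `ℱ_ℓ = σ(ξ_{κ,ι} : κ < ℓ, ι ∈ I_κ)`. -/
def noiseFiltration (ξ : (Σ κ, HaarIndex κ) → Ω → ℝ) (hξ : ∀ i, Measurable (ξ i)) :
    Filtration ℕ mΩ where
  seq l := ⨆ (i : Σ κ, HaarIndex κ) (_ : i.1 < l), MeasurableSpace.comap (ξ i) inferInstance
  mono' := fun _ _ hlm =>
    iSup₂_le fun i hi => le_iSup₂_of_le i (lt_of_lt_of_le hi hlm) le_rfl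
  le' := fun _ => iSup₂_le fun i _ => (hξ i).comap_le

/-- A (co-)biharmonic Gaussian field on the torus: a linear family `(⟨u, h⟩)`, `u ∈ H^{-2}`, of
centered Gaussian random variables with `E[⟨u, h⟩²] = 𝔨(u, u)`. The values of `X` outside `H^{-2}`
are irrelevant. -/
structure IsBiharmonicField (P : Measure Ω) (X : FormalSeries → Ω → ℝ) : Prop where
  linear : ∀ u ∈ Sobolev (-2), ∀ v ∈ Sobolev (-2), ∀ a b : ℝ,
    X (a • u + b • v) =ᵐ[P] fun ω => a * X u ω + b * X v ω
  gaussian : ∀ u ∈ Sobolev (-2), HasLaw (X u) (gaussianReal 0 (covForm u u).toNNReal) P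

/-- The family `X` has covariance function `K`: for all `u, v ∈ L²(𝕋⁴)`,
`E[⟨u, h⟩ ⟨v, h⟩] = ∬ u(x) K(x, y) v(y) dx dy`, the double integral converging absolutely. -/
def HasCovarianceFunction (P : Measure Ω) (X : FormalSeries → Ω → ℝ) (K : T4 → T4 → ℝ) : Prop :=
  ∀ u v : T4 → ℝ, MemLp u 2 volume → MemLp v 2 volume →
    Integrable (fun p : T4 × T4 => u p.1 * K p.1 p.2 * v p.2) (volume.prod volume) ∧
    ∫ ω, X (coeff u) ω * X (coeff v) ω ∂P =
      ∫ p : T4 × T4, u p.1 * K p.1 p.2 * v p.2 ∂(volume.prod volume)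

/-- `Y` is the pairing `⟨u, h⟩ = ∑ n, u_n h_n` of `u` with the random series `h`, the sum being
taken (unconditionally) in `L²(P)`. -/
def IsL2Pairing (P : Measure Ω) (u : FormalSeries) (h : Ω → FormalSeries) (Y : Ω → ℝ) : Prop :=
  MemLp Y 2 P ∧
  Tendsto (fun F : Finset Freq => eLpNorm (fun ω => (∑ n ∈ F, u n * h ω n) - Y ω) 2 P)
    atTop (𝓝 0)

end BiharmonicTorus

end

/-!
The field is a Wiener integral of the Haar coefficients. Writing `η_j` for the Haar functions and
`G u = ∑ n ≠ 0, λ_n⁻¹ u_n φ_n` for the potential of `u ∈ H^{-2}` (an element of `L²(𝕋⁴)`), the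
pairing with the partial sum is `⟨u, ĥ_ℓ⟩ = √8 π ∑_{levels < ℓ} ξ_j ⟨η_j, G u⟩`, so everything is
governed by the single identity `8π² ∑_j ⟨η_j, G u⟩² = 8π² ‖G u‖² = 𝔨(u, u)`. The proof rests on
three facts.

* The Haar functions satisfy Parseval's identity `∑_j ⟨η_j, w⟩² = ‖w‖² - (∫ w)²`
  (`hasSum_sq_integral_haar`). Summing `η_j(x) η_j(y)` over a level telescopes to the difference of
  the reproducing kernels of consecutive dyadic partitions (`sum_haar_mul_haar`), and dyadic
  averages converge in `L²` (`tendsto_cubeDefect`).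
* The grounded Green kernel is an integrable convolution kernel with Fourier coefficients `λ_n⁻¹`
  (`integrable_heatFun_sub_one`, `coeff_greenOp`). Integrability of `p_t - 1` in space and time
  follows from positivity of the heat kernel, that is, from Poisson summation for the theta
  function, for small `t`, and from the spectral gap for large `t`. With the Parseval identity for the `φ_n`
  this turns `∬ u k v` into `𝔨(u, v)` (`integral_mul_covKernel_mul`).
* The `ξ_j` are orthonormal in `L²(P)`, so that `c ↦ ∑_j c_j ξ_j` is an isometry from `ℓ²` to
  `L²(P)`, with Gaussian values (`noiseIntegral`, `hasLaw_noiseIntegral`).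

Composing, `⟨u, h⟩ := √8 π ∑_j ξ_j ⟨η_j, G u⟩` is linear in `u` and isometric for `𝔨` (`fieldLp`,
`inner_fieldLp`), and `h_n := ⟨φ_n, h⟩`. As `E h_n² = 8π² / λ_n²` for `n ≠ 0`, the assertions in
`H^{-ε}` reduce, by dominated convergence over the frequencies, to the convergence of
`∑ (1 + λ_n)^{-ε} λ_n^{-2}`, which holds in dimension four for every `ε > 0`
(`summable_rpow_mul_inv_eigenvalue_sq`). Throughout, the convention `0⁻¹ = 0` takes care of the
excluded frequency `n = 0`, because `λ_0 = 0`.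
-/

noncomputable section

namespace BiharmonicTorus

/-! ### Lattice sums over `ℤᵈ` -/

/-- Absolutely convergent sums over `ℤᵈ` of products of functions of one coordinate factorize. -/
theorem hasSum_pi_prod {𝕜 : Type*} [RCLike 𝕜] {d : ℕ} (f : Fin d → ℤ → 𝕜)
    (hf : ∀ i, Summable fun k => ‖f i k‖) :
    Summable (fun n : Fin d → ℤ => ‖∏ i, f i (n i)‖) ∧
      HasSum (fun n : Fin d → ℤ => ∏ i, f i (n i)) (∏ i, ∑' k, f i k) := by
  induction d with
  | zero =>
    refine ⟨(hasSum_fintype _).summable, ?_⟩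
    simp
  | succ d ih =>
    obtain ⟨h1, h2⟩ := ih (fun i => f i.succ) fun i => hf i.succ
    have key : ∀ p : ℤ × (Fin d → ℤ),
        ∏ i, f i (Fin.consEquiv (fun _ => ℤ) p i) = f 0 p.1 * ∏ i : Fin d, f i.succ (p.2 i) := by
      intro p
      simp [Fin.prod_univ_succ, Fin.consEquiv]
    have hs : Summable fun p : ℤ × (Fin d → ℤ) =>
        ‖f 0 p.1 * ∏ i : Fin d, f i.succ (p.2 i)‖ :=
      Summable.mul_norm (f := f 0) (g := fun n : Fin d → ℤ => ∏ i : Fin d, f i.succ (n i)) (hf 0) h1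
    constructor
    · rw [← (Fin.consEquiv fun _ => ℤ).summable_iff]
      simpa only [Function.comp_def, key] using hs
    · rw [← (Fin.consEquiv fun _ => ℤ).hasSum_iff, Fin.prod_univ_succ, ← h2.tsum_eq,
        tsum_mul_tsum_of_summable_norm (hf 0) h1]
      simpa only [Function.comp_def, key] using hs.of_norm.hasSum

theorem eigenvalue_nonneg (n : Freq) : 0 ≤ eigenvalue n := by
  unfold eigenvalue; positivity

@[simp]
theorem eigenvalue_zero : eigenvalue 0 = 0 := by simp [eigenvalue]

theorem eigenvalue_neg (n : Freq) : eigenvalue (-n) = eigenvalue n := by simp [eigenvalue]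

/-- The spectral gap of the torus. -/
theorem le_eigenvalue {n : Freq} (hn : n ≠ 0) : 4 * Real.pi ^ 2 ≤ eigenvalue n := by
  obtain ⟨i, hi⟩ := Function.ne_iff.mp hn
  have h1 : (1 : ℝ) ≤ (n i : ℝ) ^ 2 := by
    have : 0 < (n i) ^ 2 := by simp only [Pi.zero_apply] at hi; positivity
    exact_mod_cast this
  have h2 : (n i : ℝ) ^ 2 ≤ ∑ j, (n j : ℝ) ^ 2 :=
    Finset.single_le_sum (f := fun j => (n j : ℝ) ^ 2) (fun j _ => sq_nonneg _) (Finset.mem_univ i)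
  unfold eigenvalue
  exact le_mul_of_one_le_right (by positivity) (h1.trans h2)

theorem one_le_eigenvalue {n : Freq} (hn : n ≠ 0) : 1 ≤ eigenvalue n := by
  have := le_eigenvalue hn
  nlinarith [Real.pi_gt_three]

theorem eigenvalue_pos {n : Freq} (hn : n ≠ 0) : 0 < eigenvalue n :=
  zero_lt_one.trans_le (one_le_eigenvalue hn)

theorem exp_eigenvalue_eq_prod (n : Freq) (t : ℝ) :
    Real.exp (-(eigenvalue n * t)) =
      ∏ i, Real.exp (-Real.pi * (n i : ℝ) ^ 2 * (4 * Real.pi * t)) := by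
  rw [← Real.exp_sum]
  congr 1
  unfold eigenvalue
  rw [Finset.mul_sum, Finset.sum_mul, ← Finset.sum_neg_distrib]
  exact Finset.sum_congr rfl fun i _ => by ring

theorem summable_exp_int {t : ℝ} (ht : 0 < t) :
    Summable fun k : ℤ => Real.exp (-Real.pi * (k : ℝ) ^ 2 * t) := by
  simpa using (HurwitzZeta.hasSum_int_evenKernel 0 ht).summable

/-- The heat trace converges. -/
theorem summable_exp_eigenvalue {t : ℝ} (ht : 0 < t) :
    Summable fun n : Freq => Real.exp (-(eigenvalue n * t)) := by
  have := (hasSum_pi_prod (d := 4)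
    (fun _ k => Real.exp (-Real.pi * (k : ℝ) ^ 2 * (4 * Real.pi * t)))
    fun _ => (summable_exp_int (by positivity)).norm).2.summable
  simpa only [exp_eigenvalue_eq_prod] using this

theorem summable_one_add_sq_rpow {s : ℝ} (hs : 1 / 2 < s) :
    Summable fun k : ℤ => (1 + (k : ℝ) ^ 2) ^ (-s) := by
  have h := Real.summable_abs_int_rpow (b := 2 * s) (by linarith)
  refine Summable.of_norm_bounded_eventually h ?_
  have h0 : ∀ᶠ k : ℤ in cofinite, k ≠ 0 :=
    Filter.eventually_cofinite.mpr (by simp)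
  filter_upwards [h0] with k hk
  have hk' : 0 < |(k : ℝ)| := by positivity
  rw [Real.norm_of_nonneg (by positivity)]
  have : |(k : ℝ)| ^ (-(2 * s)) = ((k : ℝ) ^ 2) ^ (-s) := by
    rw [← sq_abs, ← Real.rpow_natCast, ← Real.rpow_mul hk'.le]
    congr 1; push_cast; ring
  rw [this]
  exact Real.rpow_le_rpow_of_nonpos (by positivity) (by linarith) (by linarith)

/-- The number `4` of dimensions enters here: `∑ (1 + |n|²)^{-s}` converges for `s > 2`. -/
theorem summable_one_add_eigenvalue_rpow {s : ℝ} (hs : 2 < s) :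
    Summable fun n : Freq => (1 + eigenvalue n) ^ (-s) := by
  have h := (hasSum_pi_prod (d := 4) (fun _ k => (1 + (k : ℝ) ^ 2) ^ (-(s / 4)))
    fun _ => (summable_one_add_sq_rpow (by linarith)).norm).2.summable
  refine Summable.of_nonneg_of_le
    (fun n => Real.rpow_nonneg (by linarith [eigenvalue_nonneg n]) _) (fun n => ?_) h
  have hle : ∀ j, 1 + (n j : ℝ) ^ 2 ≤ 1 + eigenvalue n := by
    intro j
    have h2 : (n j : ℝ) ^ 2 ≤ ∑ j, (n j : ℝ) ^ 2 :=
      Finset.single_le_sum (f := fun j => (n j : ℝ) ^ 2) (fun j _ => sq_nonneg _)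
        (Finset.mem_univ j)
    have h3 : (1 : ℝ) ≤ 4 * Real.pi ^ 2 := by nlinarith [Real.pi_gt_three]
    unfold eigenvalue
    nlinarith [sq_nonneg (n j : ℝ)]
  have h1 : (1 + eigenvalue n) ^ (-s) = ∏ _j : Fin 4, (1 + eigenvalue n) ^ (-(s / 4)) := by
    rw [Finset.prod_const, ← Real.rpow_natCast, ← Real.rpow_mul (by linarith [eigenvalue_nonneg n])]
    congr 1; simp
  rw [h1]
  refine Finset.prod_le_prod
    (fun _ _ => Real.rpow_nonneg (by linarith [eigenvalue_nonneg n]) _) fun j _ => ?_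
  exact Real.rpow_le_rpow_of_nonpos (by positivity) (hle j) (by linarith)

theorem inv_eigenvalue_sq_le (n : Freq) :
    (eigenvalue n ^ 2)⁻¹ ≤ 4 * (1 + eigenvalue n) ^ (-2 : ℝ) := by
  by_cases hn : n = 0
  · simp [hn]
  have h := one_le_eigenvalue hn
  rw [Real.rpow_neg (by linarith), show (2 : ℝ) = ((2 : ℕ) : ℝ) by norm_num, Real.rpow_natCast,
    ← div_eq_mul_inv, inv_eq_one_div, div_le_div_iff₀ (by positivity) (by positivity)]
  nlinarith

/-- The field is of negative regularity only: `E ‖h‖²_{H^{-ε}}` is a multiple of this sum. -/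
theorem summable_rpow_mul_inv_eigenvalue_sq {ε : ℝ} (hε : 0 < ε) :
    Summable fun n : Freq => (1 + eigenvalue n) ^ (-ε) * (eigenvalue n ^ 2)⁻¹ := by
  refine Summable.of_nonneg_of_le (fun n => ?_) (fun n => ?_)
    ((summable_one_add_eigenvalue_rpow (s := 2 + ε) (by linarith)).mul_left 4)
  · have := eigenvalue_nonneg n
    positivity
  · have h0 : 0 < 1 + eigenvalue n := by linarith [eigenvalue_nonneg n]
    rw [show -(2 + ε) = -ε + -2 by ring, Real.rpow_add h0]
    calc _ ≤ (1 + eigenvalue n) ^ (-ε) * (4 * (1 + eigenvalue n) ^ (-2 : ℝ)) :=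
          mul_le_mul_of_nonneg_left (inv_eigenvalue_sq_le n) (by positivity)
      _ = _ := by ring

/-! ### The real eigenfunctions as a Hilbert basis -/

open UnitAddTorus

theorem volume_circle_eq : (volume : Measure UnitAddCircle) = AddCircle.haarAddCircle := by
  rw [AddCircle.volume_eq_smul_haarAddCircle]; simp

instance : IsProbabilityMeasure (volume : Measure UnitAddCircle) :=
  ⟨UnitAddCircle.measure_univ⟩

instance : IsProbabilityMeasure (volume : Measure T4) :=
  inferInstanceAs
    (IsProbabilityMeasure (Measure.pi fun _ : Fin 4 => (volume : Measure UnitAddCircle)))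

instance : (volume : Measure T4).IsAddHaarMeasure :=
  inferInstanceAs (Measure.pi fun _ : Fin 4 => (volume : Measure UnitAddCircle)).IsAddHaarMeasure

instance : (volume : Measure UnitAddCircle).IsNegInvariant :=
  Measure.IsAddHaarMeasure.isNegInvariant_of_regular _

instance : (volume : Measure T4).IsNegInvariant :=
  inferInstanceAs
    (Measure.pi fun _ : Fin 4 => (volume : Measure UnitAddCircle)).IsNegInvariant

theorem volume_torus_eq :
    (volume : Measure T4) = Measure.pi fun _ => AddCircle.haarAddCircle := by
  rw [← volume_circle_eq]; rfl

theorem integral_fourier (k : ℤ) :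
    ∫ x : UnitAddCircle, fourier k x = if k = 0 then 1 else 0 := by
  rw [volume_circle_eq]
  have := orthonormal_iff_ite.mp (orthonormal_fourier (T := 1)) 0 k
  rw [ContinuousMap.inner_toLp] at this
  simpa [eq_comm] using this

/-- Orthogonality of the characters, for the normalized Lebesgue measure `volume`. -/
theorem integral_mFourier (n : Freq) :
    ∫ x : T4, mFourier n x = if n = 0 then 1 else 0 := by
  have h : ∫ x : T4, mFourier n x = ∏ i, ∫ x : UnitAddCircle, fourier (n i) x :=
    integral_fintype_prod_volume_eq_prod fun i x => fourier (n i) x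
  rw [h]
  simp_rw [integral_fourier]
  split_ifs with h0
  · simp [h0]
  · obtain ⟨i, hi⟩ := Function.ne_iff.mp h0
    exact Finset.prod_eq_zero (Finset.mem_univ i) (if_neg hi)

theorem ae_eq_zero_of_integral_mFourier_aux (μ : Measure T4)
    (hμ : μ = Measure.pi fun _ => AddCircle.haarAddCircle) (f : T4 → ℂ) (hf : MemLp f 2 μ)
    (h : ∀ n : Freq, ∫ x, mFourier n x * f x ∂μ = 0) : f =ᵐ[μ] 0 := by
  subst hμ
  have h1 := UnitAddTorus.hasSum_sq_mFourierCoeff (d := Fin 4) (hf.toLp f)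
  have h2 : ∀ n : Freq, mFourierCoeff (hf.toLp f) n = 0 := fun n => by
    rw [← h (-n)]
    refine integral_congr_ae ?_
    filter_upwards [hf.coeFn_toLp] with x hx
    rw [smul_eq_mul, hx]
  simp only [h2, norm_zero, ne_eq, OfNat.ofNat_ne_zero, not_false_eq_true, zero_pow] at h1
  have h3 := h1.unique hasSum_zero
  have h4 := (integral_eq_zero_iff_of_nonneg (fun x => by positivity)
    ((Lp.memLp (hf.toLp f)).integrable_norm_pow (by simp))).mp h3
  filter_upwards [hf.coeFn_toLp, h4] with x hx hx'
  rw [← hx]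
  simpa using hx'

theorem norm_mFourier_apply (n : Freq) (x : T4) : ‖mFourier n x‖ = 1 := by
  simp [mFourier, Circle.norm_coe]

theorem mFourier_add_apply (n : Freq) (x y : T4) :
    mFourier n (x + y) = mFourier n x * mFourier n y := by
  simp [mFourier, fourier_apply, Finset.prod_mul_distrib, AddCircle.toCircle_add]

theorem mFourier_neg_apply (n : Freq) (x : T4) :
    mFourier n (-x) = (starRingEnd ℂ) (mFourier n x) := by
  rw [← mFourier_neg]
  simp [mFourier, fourier_apply]

theorem abs_eigenfunction_le (n : Freq) (x : T4) : |eigenfunction n x| ≤ 2 := by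
  have h1 := Complex.abs_re_le_norm (mFourier n x)
  have h2 := Complex.abs_im_le_norm (mFourier n x)
  rw [norm_mFourier_apply] at h1 h2
  unfold eigenfunction
  exact (abs_add_le _ _).trans (by linarith)

@[fun_prop]
theorem continuous_eigenfunction (n : Freq) : Continuous (eigenfunction n) := by
  unfold eigenfunction
  fun_prop

theorem eigenfunction_zero (x : T4) : eigenfunction 0 x = 1 := by
  simp [eigenfunction, mFourier_zero]

theorem eigenfunction_neg (n : Freq) (x : T4) :
    eigenfunction (-n) x = (mFourier n x).re - (mFourier n x).im := by
  simp [eigenfunction, mFourier_neg, sub_eq_add_neg]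

/-- In real terms: `φ_n(x) φ_m(x) = sin (2π (n + m)·x) + cos (2π (n - m)·x)`. -/
theorem eigenfunction_mul (n m : Freq) (x : T4) :
    eigenfunction n x * eigenfunction m x =
      (mFourier (n + m) x).im + (mFourier (n - m) x).re := by
  rw [sub_eq_add_neg, mFourier_add, mFourier_add, mFourier_neg]
  simp only [eigenfunction, Complex.mul_im, Complex.mul_re, Complex.conj_re, Complex.conj_im]
  ring

theorem integrable_of_continuous {E : Type*} [NormedAddCommGroup E] {f : T4 → E}
    (hf : Continuous f) : Integrable f volume :=
  integrableOn_univ.mp (hf.continuousOn.integrableOn_compact isCompact_univ)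

theorem integral_re_mFourier (n : Freq) :
    ∫ x : T4, (mFourier n x).re = if n = 0 then 1 else 0 := by
  have := integral_re (𝕜 := ℂ) (integrable_of_continuous (mFourier n).continuous)
  simp only [RCLike.re_eq_complex_re, integral_mFourier] at this
  rw [this]; split_ifs <;> simp

theorem integral_im_mFourier (n : Freq) : ∫ x : T4, (mFourier n x).im = 0 := by
  have := integral_im (𝕜 := ℂ) (integrable_of_continuous (mFourier n).continuous)
  simp only [RCLike.im_eq_complex_im, integral_mFourier] at this
  rw [this]; split_ifs <;> simp

theorem integral_eigenfunction_mul (n m : Freq) :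
    ∫ x, eigenfunction n x * eigenfunction m x = if n = m then 1 else 0 := by
  simp_rw [eigenfunction_mul]
  rw [integral_add (integrable_of_continuous (by fun_prop))
    (integrable_of_continuous (by fun_prop)), integral_im_mFourier, integral_re_mFourier]
  simp [sub_eq_zero]

theorem memLp_eigenfunction (n : Freq) (p : ℝ≥0∞) : MemLp (eigenfunction n) p volume :=
  MemLp.of_bound (continuous_eigenfunction n).aestronglyMeasurable 2
    (Eventually.of_forall fun x => by simpa using abs_eigenfunction_le n x)

/-- The real Hilbert space `L²(𝕋⁴)`. -/
abbrev L2T : Type := Lp ℝ 2 (volume : Measure T4)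

theorem inner_toLp {α : Type*} [MeasurableSpace α] {μ : Measure α} {u v : α → ℝ}
    (hu : MemLp u 2 μ) (hv : MemLp v 2 μ) :
    inner ℝ (hu.toLp u) (hv.toLp v) = ∫ x, u x * v x ∂μ := by
  rw [L2.inner_def]
  refine integral_congr_ae ?_
  filter_upwards [hu.coeFn_toLp, hv.coeFn_toLp] with x h1 h2
  simp [h1, h2, mul_comm]

theorem inner_eq_integral (f g : L2T) : inner ℝ f g = ∫ x, f x * g x := by
  rw [L2.inner_def]
  simp [mul_comm]

/-- The eigenfunction `φ_n` as an element of `L²(𝕋⁴)`. -/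
def eigenfunctionLp (n : Freq) : L2T := (memLp_eigenfunction n 2).toLp (eigenfunction n)

theorem inner_eigenfunctionLp (n : Freq) (f : L2T) :
    inner ℝ (eigenfunctionLp n) f = coeff f n := by
  rw [inner_eq_integral]
  refine integral_congr_ae ?_
  filter_upwards [(memLp_eigenfunction n 2).coeFn_toLp] with x h1
  rw [eigenfunctionLp, h1, mul_comm]

theorem orthonormal_eigenfunctionLp : Orthonormal ℝ eigenfunctionLp := by
  rw [orthonormal_iff_ite]
  intro n m
  rw [eigenfunctionLp, eigenfunctionLp, inner_toLp, integral_eigenfunction_mul]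

/-- The eigenfunctions `φ_n` as a Hilbert basis of the real space `L²(𝕋⁴)`. -/
def eigenBasis : HilbertBasis Freq ℝ L2T :=
  HilbertBasis.mkOfOrthogonalEqBot orthonormal_eigenfunctionLp <| by
    rw [Submodule.eq_bot_iff]
    intro f hf
    have h0 : ∀ n, coeff f n = 0 := fun n => by
      rw [← inner_eigenfunctionLp]
      exact Submodule.mem_orthogonal _ _ |>.mp hf _ (Submodule.subset_span ⟨n, rfl⟩)
    have hint : Integrable f volume := (Lp.memLp f).integrable one_le_two
    have hre : ∀ n : Freq, Integrable (fun x : T4 => f x * (mFourier n x).re) volume := fun n =>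
      hint.mul_bdd (c := 1) (by fun_prop) (Eventually.of_forall fun x =>
        (Complex.abs_re_le_norm _).trans (norm_mFourier_apply n x).le)
    have him : ∀ n : Freq, Integrable (fun x : T4 => f x * (mFourier n x).im) volume := fun n =>
      hint.mul_bdd (c := 1) (by fun_prop) (Eventually.of_forall fun x =>
        (Complex.abs_im_le_norm _).trans (norm_mFourier_apply n x).le)
    -- the coefficients of `f` with respect to `φ_n` and `φ_{-n}` determine the complex ones
    have h1 : ∀ n : Freq, ∫ x : T4, f x * (mFourier n x).re = 0 ∧
        ∫ x : T4, f x * (mFourier n x).im = 0 := by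
      intro n
      have a1 := h0 n
      have a2 := h0 (-n)
      simp only [coeff, eigenfunction_neg] at a1 a2
      simp only [eigenfunction, mul_add, mul_sub] at a1 a2
      rw [integral_add (hre n) (him n)] at a1
      rw [integral_sub (hre n) (him n)] at a2
      constructor <;> linarith
    have h2 : (fun x => (f x : ℂ)) =ᵐ[volume] 0 := by
      refine ae_eq_zero_of_integral_mFourier_aux _ volume_torus_eq _ (Lp.memLp f).ofReal fun n => ?_
      have hi : Integrable (fun x : T4 => mFourier n x * (f x : ℂ)) volume :=
        hint.ofReal.bdd_mul (c := 1) (by fun_prop)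
          (Eventually.of_forall fun x => (norm_mFourier_apply n x).le)
      apply Complex.ext
      · have := integral_re (𝕜 := ℂ) hi
        simp only [RCLike.re_eq_complex_re] at this
        rw [← this, Complex.zero_re, ← (h1 n).1]
        exact integral_congr_ae (Eventually.of_forall fun x => by simp [mul_comm])
      · have := integral_im (𝕜 := ℂ) hi
        simp only [RCLike.im_eq_complex_im] at this
        rw [← this, Complex.zero_im, ← (h1 n).2]
        exact integral_congr_ae (Eventually.of_forall fun x => by simp [mul_comm])
    refine (Lp.eq_zero_iff_ae_eq_zero).mpr ?_
    filter_upwards [h2] with x hx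
    simpa using hx

theorem eigenBasis_apply (n : Freq) : eigenBasis n = eigenfunctionLp n := by
  simp [eigenBasis]

theorem eigenBasis_repr (f : L2T) (n : Freq) : eigenBasis.repr f n = coeff f n := by
  rw [HilbertBasis.repr_apply_apply, eigenBasis_apply, inner_eigenfunctionLp]

theorem coeff_congr {u v : T4 → ℝ} (h : u =ᵐ[volume] v) : coeff u = coeff v := by
  funext n
  exact integral_congr_ae (h.mono fun x hx => by simp [hx])

/-- Parseval's identity. -/
theorem hasSum_coeff_mul_coeff {u v : T4 → ℝ} (hu : MemLp u 2 volume) (hv : MemLp v 2 volume) :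
    HasSum (fun n => coeff u n * coeff v n) (∫ x, u x * v x) := by
  rw [← inner_toLp hu hv]
  have := eigenBasis.hasSum_inner_mul_inner (hu.toLp u) (hv.toLp v)
  simp only [eigenBasis_apply] at this
  refine this.congr_fun fun n => ?_
  rw [real_inner_comm, inner_eigenfunctionLp, inner_eigenfunctionLp, coeff_congr hu.coeFn_toLp,
    coeff_congr hv.coeFn_toLp]

/-! ### The heat kernel and the grounded Green kernel -/

open HurwitzZeta

/-- The translation-invariant form of the heat kernel: a product of one-dimensional theta
functions. -/
def heatFun (t : ℝ) (z : T4) : ℝ := ∏ j, cosKernel (z j) (4 * Real.pi * t)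

theorem hasSum_fourier_mul_exp (a : UnitAddCircle) {t : ℝ} (ht : 0 < t) :
    HasSum (fun k : ℤ => fourier k a * (Real.exp (-Real.pi * (k : ℝ) ^ 2 * t) : ℂ))
      (cosKernel a t) := by
  induction a using QuotientAddGroup.induction_on with
  | H a =>
    refine (hasSum_int_cosKernel a ht).congr_fun fun k => ?_
    rw [fourier_coe_apply]
    congr 2
    simp; ring

theorem hasSum_heatFun {t : ℝ} (ht : 0 < t) (z : T4) :
    HasSum (fun n : Freq => (Real.exp (-(eigenvalue n * t)) : ℂ) * mFourier n z)
      (heatFun t z : ℂ) := by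
  have ht' : 0 < 4 * Real.pi * t := by positivity
  have h := (hasSum_pi_prod (𝕜 := ℂ) (d := 4)
    (fun i k => fourier k (z i) * (Real.exp (-Real.pi * (k : ℝ) ^ 2 * (4 * Real.pi * t)) : ℂ))
    fun i => by
      simpa [fourier_apply, Circle.norm_coe, Complex.norm_exp, ← Complex.ofReal_exp] using
        summable_exp_int ht').2
  simp only [(hasSum_fourier_mul_exp _ ht').tsum_eq] at h
  rw [heatFun, Complex.ofReal_prod]
  refine h.congr_fun fun n => ?_
  rw [exp_eigenvalue_eq_prod, Complex.ofReal_prod, Finset.prod_mul_distrib, mul_comm]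
  rfl

theorem hasSum_heatFun_re {t : ℝ} (ht : 0 < t) (z : T4) :
    HasSum (fun n : Freq => Real.exp (-(eigenvalue n * t)) * (mFourier n z).re)
      (heatFun t z) := by
  simpa only [Complex.re_ofReal_mul, Complex.ofReal_re] using
    Complex.hasSum_re (hasSum_heatFun ht z)

theorem hasSum_heatFun_im {t : ℝ} (ht : 0 < t) (z : T4) :
    HasSum (fun n : Freq => Real.exp (-(eigenvalue n * t)) * (mFourier n z).im) 0 := by
  simpa only [Complex.im_ofReal_mul, Complex.ofReal_im] using
    Complex.hasSum_im (hasSum_heatFun ht z)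

/-- `φ_n(x) φ_n(y) = cos (2π n·(x - y)) + sin (2π n·(x + y))`. -/
theorem eigenfunction_mul_apply (n : Freq) (x y : T4) :
    eigenfunction n x * eigenfunction n y =
      (mFourier n (x - y)).re + (mFourier n (x + y)).im := by
  rw [sub_eq_add_neg, mFourier_add_apply, mFourier_add_apply, mFourier_neg_apply]
  simp only [eigenfunction, Complex.mul_im, Complex.mul_re, Complex.conj_re, Complex.conj_im]
  ring

theorem heatKernel_eq {t : ℝ} (ht : 0 < t) (x y : T4) :
    heatKernel t x y = heatFun t (x - y) := by
  have h := (hasSum_heatFun_re ht (x - y)).add (hasSum_heatFun_im ht (x + y))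
  rw [add_zero] at h
  rw [heatKernel, ← h.tsum_eq]
  exact tsum_congr fun n => by rw [eigenfunction_mul_apply]; ring

/-- Positivity of the heat kernel. By Poisson summation, the theta functions are sums of
Gaussians. -/
theorem heatFun_nonneg {t : ℝ} (ht : 0 < t) (z : T4) : 0 ≤ heatFun t z := by
  refine Finset.prod_nonneg fun j _ => ?_
  generalize z j = a
  have hs : 0 < (4 * Real.pi * t) := by positivity
  generalize 4 * Real.pi * t = s at hs
  have h1 : evenKernel a (1 / s) = 1 / (1 / s) ^ (1 / 2 : ℝ) * cosKernel a s := by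
    rw [evenKernel_functional_equation, one_div_one_div]
  have h2 : 0 ≤ evenKernel a (1 / s) := by
    induction a using QuotientAddGroup.induction_on with
    | H a => exact (hasSum_int_evenKernel a (by positivity)).nonneg fun k => (Real.exp_pos _).le
  rw [h1] at h2
  exact nonneg_of_mul_nonneg_right h2 (by positivity)

theorem continuous_heatFun {t : ℝ} (ht : 0 < t) : Continuous (heatFun t) := by
  have : heatFun t = fun z => ∑' n : Freq, Real.exp (-(eigenvalue n * t)) * (mFourier n z).re :=
    funext fun z => (hasSum_heatFun_re ht z).tsum_eq.symm
  rw [this]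
  refine continuous_tsum (fun n => by fun_prop) (summable_exp_eigenvalue ht) fun n z => ?_
  rw [norm_mul, Real.norm_of_nonneg (Real.exp_pos _).le]
  exact mul_le_of_le_one_right (Real.exp_pos _).le
    ((Complex.abs_re_le_norm _).trans (norm_mFourier_apply n z).le)

theorem integral_heatFun_mul_mFourier {t : ℝ} (ht : 0 < t) (m : Freq) :
    ∫ z : T4, (heatFun t z : ℂ) * mFourier m z = Real.exp (-(eigenvalue m * t)) := by
  have hint : ∀ n : Freq, Integrable (fun z : T4 =>
      (Real.exp (-(eigenvalue n * t)) : ℂ) * mFourier n z * mFourier m z) volume := fun n =>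
    integrable_of_continuous (by fun_prop)
  have h := hasSum_integral_of_summable_integral_norm hint (by
    simpa [norm_mFourier_apply, Complex.norm_exp] using summable_exp_eigenvalue ht)
  have h1 : ∀ z : T4, ∑' n : Freq, (Real.exp (-(eigenvalue n * t)) : ℂ) * mFourier n z *
      mFourier m z = (heatFun t z : ℂ) * mFourier m z := fun z =>
    ((hasSum_heatFun ht z).mul_right _).tsum_eq
  simp_rw [h1] at h
  refine h.unique ?_
  have h2 : ∀ n : Freq, ∫ z : T4, (Real.exp (-(eigenvalue n * t)) : ℂ) * mFourier n z *
      mFourier m z = if n = -m then (Real.exp (-(eigenvalue m * t)) : ℂ) else 0 := fun n => by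
    simp_rw [mul_assoc, ← mFourier_add, integral_const_mul, integral_mFourier,
      add_eq_zero_iff_eq_neg]
    split_ifs with h0
    · rw [h0, eigenvalue_neg, mul_one]
    · simp
  simp_rw [h2]
  exact hasSum_ite_eq (-m) _

theorem integral_heatFun {t : ℝ} (ht : 0 < t) : ∫ z : T4, heatFun t z = 1 := by
  have h := integral_heatFun_mul_mFourier ht 0
  simp only [mFourier_zero, ContinuousMap.one_apply, mul_one, eigenvalue_zero, zero_mul, neg_zero,
    Real.exp_zero] at h
  rw [integral_complex_ofReal] at h
  exact_mod_cast h

/-- Exponential convergence to equilibrium, by the spectral gap. -/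
theorem abs_heatFun_sub_one_le {t : ℝ} (ht : 1 ≤ t) (z : T4) :
    |heatFun t z - 1| ≤ (∑' n : Freq, Real.exp (-(eigenvalue n * 1))) * Real.exp (-(t - 1)) := by
  have ht0 : 0 < t := by linarith
  have h := hasSum_ite_sub_hasSum (hasSum_heatFun_re ht0 z) 0
  simp only [eigenvalue_zero, zero_mul, neg_zero, Real.exp_zero, one_mul, mFourier_zero,
    ContinuousMap.one_apply, Complex.one_re] at h
  rw [← tsum_mul_right, ← h.tsum_eq, ← Real.norm_eq_abs]
  refine tsum_of_norm_bounded
    ((summable_exp_eigenvalue zero_lt_one).mul_right _).hasSum fun n => ?_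
  split_ifs with h0
  · rw [norm_zero]; positivity
  · rw [norm_mul, Real.norm_of_nonneg (Real.exp_pos _).le, ← Real.exp_add]
    refine (mul_le_of_le_one_right (Real.exp_pos _).le
      ((Complex.abs_re_le_norm _).trans (norm_mFourier_apply n z).le)).trans ?_
    refine Real.exp_le_exp.mpr ?_
    nlinarith [one_le_eigenvalue h0]

theorem integrable_heatFun {t : ℝ} (ht : 0 < t) : Integrable (heatFun t) volume :=
  integrable_of_continuous (continuous_heatFun ht)

theorem integral_norm_heatFun_sub_one_le {t : ℝ} (ht : 0 < t) :
    ∫ z : T4, ‖heatFun t z - 1‖ ≤ (Set.Ioc (0 : ℝ) 1).indicator (fun _ => 2) t +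
      (∑' n : Freq, Real.exp (-(eigenvalue n * 1))) * Real.exp 1 * Real.exp (-t) := by
  have hC : 0 ≤ ∑' n : Freq, Real.exp (-(eigenvalue n * 1)) := tsum_nonneg fun n => by positivity
  rcases le_total t 1 with h | h
  · rw [Set.indicator_of_mem (show t ∈ Set.Ioc (0 : ℝ) 1 from ⟨ht, h⟩)]
    refine le_add_of_le_of_nonneg ?_ (by positivity)
    have h1 : ∀ z : T4, ‖heatFun t z - 1‖ ≤ heatFun t z + 1 := fun z => by
      have := heatFun_nonneg ht z
      rw [Real.norm_eq_abs, abs_le]; constructor <;> linarith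
    calc ∫ z : T4, ‖heatFun t z - 1‖ ≤ ∫ z : T4, (heatFun t z + 1) :=
          integral_mono ((integrable_heatFun ht).sub (integrable_const 1)).norm
            ((integrable_heatFun ht).add (integrable_const 1)) h1
      _ = 2 := by
        rw [integral_add (integrable_heatFun ht) (integrable_const 1), integral_heatFun ht]
        simp; norm_num
  · refine le_add_of_nonneg_of_le (Set.indicator_nonneg (fun _ _ => by norm_num) _) ?_
    calc ∫ z : T4, ‖heatFun t z - 1‖ ≤
          ∫ z : T4, (∑' n : Freq, Real.exp (-(eigenvalue n * 1))) * Real.exp (-(t - 1)) :=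
          integral_mono ((integrable_heatFun ht).sub (integrable_const 1)).norm
            (integrable_const _) fun z => abs_heatFun_sub_one_le h z
      _ = _ := by
        rw [integral_const, probReal_univ, one_smul, mul_assoc, ← Real.exp_add]
        congr 2; ring

/-- The Green kernel is integrable: this is where positivity of the heat kernel (for small times)
and the spectral gap (for large times) are used. -/
theorem integrable_heatFun_sub_one :
    Integrable (fun p : ℝ × T4 => heatFun p.1 p.2 - 1)
      ((volume.restrict (Set.Ioi (0 : ℝ))).prod volume) := by
  have hpos : ∀ᵐ t ∂(volume.restrict (Set.Ioi (0 : ℝ))), 0 < t :=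
    ae_restrict_mem measurableSet_Ioi
  have hmeas : AEStronglyMeasurable (fun p : ℝ × T4 => heatFun p.1 p.2)
      ((volume.restrict (Set.Ioi (0 : ℝ))).prod volume) := by
    refine aestronglyMeasurable_of_tendsto_ae (atTop : Filter (Finset Freq))
      (f := fun F p => ∑ n ∈ F, Real.exp (-(eigenvalue n * p.1)) * (mFourier n p.2).re)
      (fun F => Continuous.aestronglyMeasurable (by fun_prop)) ?_
    filter_upwards [Measure.quasiMeasurePreserving_fst.ae hpos] with p hp
    exact hasSum_heatFun_re hp p.2
  have hmeas' : AEStronglyMeasurable (fun p : ℝ × T4 => heatFun p.1 p.2 - 1)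
      ((volume.restrict (Set.Ioi (0 : ℝ))).prod volume) := hmeas.sub aestronglyMeasurable_const
  rw [integrable_prod_iff hmeas']
  constructor
  · filter_upwards [hpos] with t ht
    exact (integrable_heatFun ht).sub (integrable_const 1)
  · refine Integrable.mono' (g := fun t => (Set.Ioc (0 : ℝ) 1).indicator (fun _ => 2) t +
      (∑' n : Freq, Real.exp (-(eigenvalue n * 1))) * Real.exp 1 * Real.exp (-t)) ?_
      hmeas'.norm.integral_prod_right' ?_
    · refine Integrable.add ?_ (Integrable.const_mul (integrableOn_exp_neg_Ioi 0) _)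
      refine Integrable.integrableOn ?_
      exact (integrable_indicator_iff measurableSet_Ioc).mpr (integrableOn_const (by simp))
    · filter_upwards [hpos] with t ht
      rw [Real.norm_of_nonneg (integral_nonneg fun z => norm_nonneg _)]
      exact integral_norm_heatFun_sub_one_le ht

/-- The grounded Green kernel as a function of the difference of its arguments. -/
def greenFun (z : T4) : ℝ := ∫ t in Set.Ioi (0 : ℝ), (heatFun t z - 1)

theorem greenKernel_eq (x y : T4) : greenKernel x y = greenFun (x - y) :=
  setIntegral_congr_fun measurableSet_Ioi fun t ht => by
    simp only [heatKernel_eq ht]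

theorem greenKernel_comm (x y : T4) : greenKernel x y = greenKernel y x := by
  simp only [greenKernel, heatKernel, mul_comm]

theorem integrable_greenFun : Integrable greenFun volume :=
  integrable_heatFun_sub_one.integral_prod_right

/-- The Fourier coefficients of the Green kernel; both sides vanish for `m = 0`, the right one
because of the convention `0⁻¹ = 0`. -/
theorem integral_greenFun_mul_mFourier (m : Freq) :
    ∫ z : T4, (greenFun z : ℂ) * mFourier m z = ((eigenvalue m)⁻¹ : ℝ) := by
  have hint : Integrable (fun p : ℝ × T4 => ((heatFun p.1 p.2 - 1 : ℝ) : ℂ) * mFourier m p.2)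
      ((volume.restrict (Set.Ioi (0 : ℝ))).prod volume) :=
    integrable_heatFun_sub_one.ofReal.mul_bdd (c := 1)
      (Continuous.aestronglyMeasurable (by fun_prop))
      (Eventually.of_forall fun p => (norm_mFourier_apply m p.2).le)
  have h1 : ∀ z : T4, (greenFun z : ℂ) * mFourier m z =
      ∫ t in Set.Ioi (0 : ℝ), ((heatFun t z - 1 : ℝ) : ℂ) * mFourier m z := fun z => by
    rw [integral_mul_const, integral_complex_ofReal]; rfl
  simp_rw [h1]
  rw [← integral_integral_swap hint]
  have h2 : ∀ t ∈ Set.Ioi (0 : ℝ), ∫ z : T4, ((heatFun t z - 1 : ℝ) : ℂ) * mFourier m z =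
      ((Real.exp (-(eigenvalue m * t)) - if m = 0 then 1 else 0 : ℝ) : ℂ) := fun t ht => by
    simp_rw [Complex.ofReal_sub, sub_mul, Complex.ofReal_one, one_mul]
    have hc := continuous_heatFun ht
    rw [integral_sub (integrable_of_continuous (by fun_prop))
      (integrable_of_continuous (by fun_prop)), integral_heatFun_mul_mFourier ht,
      integral_mFourier]
    split_ifs <;> simp
  rw [setIntegral_congr_fun measurableSet_Ioi h2, integral_complex_ofReal]
  congr 1
  by_cases hm : m = 0
  · simp [hm]
  · simp only [hm, if_false, sub_zero]
    have := integral_exp_mul_Ioi (a := -eigenvalue m) (by simpa using eigenvalue_pos hm) 0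
    simp only [neg_mul] at this
    rw [this]; simp

/-- Products of an integrable function of `a` with a translate `y ↦ g(φ(a) - y)` of an integrable
function on the torus are jointly integrable. -/
theorem integrable_mul_translate {α : Type*} [MeasurableSpace α] {μ : Measure α} [SFinite μ]
    {f : α → ℝ} (hf : Integrable f μ) {g : T4 → ℝ} (hg : Integrable g volume)
    {φ : α → T4} (hφ : Measurable φ) :
    Integrable (fun p : α × T4 => f p.1 * g (φ p.1 - p.2)) (μ.prod volume) := by
  have hmp : MeasurePreserving (fun p : α × T4 => (p.1, φ p.1 - p.2)) (μ.prod volume)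
      (μ.prod volume) :=
    (MeasurePreserving.id μ).skew_product (g := fun a y => φ a - y)
      (by fun_prop) (Eventually.of_forall fun a =>
        (Measure.measurePreserving_sub_left volume (φ a)).map_eq)
  exact (hmp.integrable_comp (hf.mul_prod hg).aestronglyMeasurable).mpr (hf.mul_prod hg)

theorem eigenfunction_eq_re (n : Freq) (x : T4) :
    eigenfunction n x = ((1 - Complex.I) * mFourier n x).re := by
  simp [eigenfunction]

theorem integral_greenKernel_mul_eigenfunction (n : Freq) (y : T4) :
    ∫ x, greenKernel x y * eigenfunction n x = (eigenvalue n)⁻¹ * eigenfunction n y := by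
  have hint : Integrable (fun z : T4 => (greenFun z : ℂ) * mFourier n z) volume :=
    integrable_greenFun.ofReal.mul_bdd (c := 1) (by fun_prop)
      (Eventually.of_forall fun x => (norm_mFourier_apply n x).le)
  calc ∫ x, greenKernel x y * eigenfunction n x
      = ∫ x, (fun z => greenFun z * eigenfunction n (z + y)) (x - y) := by
        simp [greenKernel_eq]
    _ = ∫ z, greenFun z * eigenfunction n (z + y) :=
        integral_sub_right_eq_self (μ := volume)
          (fun z => greenFun z * eigenfunction n (z + y)) y
    _ = ∫ z, RCLike.re (((1 - Complex.I) * mFourier n y) * ((greenFun z : ℂ) * mFourier n z)) := by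
        refine integral_congr_ae (Eventually.of_forall fun z => ?_)
        simp only [eigenfunction_eq_re, mFourier_add_apply, RCLike.re_eq_complex_re]
        rw [← Complex.re_ofReal_mul]
        congr 1; ring
    _ = (eigenvalue n)⁻¹ * eigenfunction n y := by
        rw [integral_re (hint.const_mul _), integral_const_mul, integral_greenFun_mul_mFourier,
          RCLike.re_eq_complex_re, mul_comm, Complex.re_ofReal_mul, eigenfunction_eq_re]

theorem integrable_greenKernel_mul {u : T4 → ℝ} (hu : Integrable u volume) :
    Integrable (fun p : T4 × T4 => u p.1 * greenKernel p.1 p.2) (volume.prod volume) := by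
  simp_rw [greenKernel_eq]
  exact integrable_mul_translate (φ := fun x => x) hu integrable_greenFun measurable_id'

theorem greenOp_eq (u : T4 → ℝ) (x : T4) : greenOp u x = ∫ y, u y * greenKernel y x := by
  unfold greenOp
  simp only [greenKernel_comm x, mul_comm]

theorem integrable_greenOp {u : T4 → ℝ} (hu : Integrable u volume) :
    Integrable (greenOp u) volume := by
  rw [funext (greenOp_eq u)]
  exact (integrable_greenKernel_mul hu).integral_prod_right

/-- The grounded Green operator is the Fourier multiplier `λ_n⁻¹` off constants, and it kills
constants (`0⁻¹ = 0`). -/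
theorem coeff_greenOp {u : T4 → ℝ} (hu : Integrable u volume) (n : Freq) :
    coeff (greenOp u) n = (eigenvalue n)⁻¹ * coeff u n := by
  have hint : Integrable (fun p : T4 × T4 => u p.1 * greenKernel p.1 p.2 * eigenfunction n p.2)
      (volume.prod volume) :=
    (integrable_greenKernel_mul hu).mul_bdd (c := 2)
      (Continuous.aestronglyMeasurable (by fun_prop))
      (Eventually.of_forall fun p => abs_eigenfunction_le n p.2)
  have h1 : ∀ x, greenOp u x * eigenfunction n x =
      ∫ y, u y * greenKernel y x * eigenfunction n x := fun x => by
    rw [integral_mul_const, greenOp_eq]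
  unfold coeff
  simp_rw [h1]
  rw [← integral_integral_swap hint, ← integral_const_mul]
  refine integral_congr_ae (Eventually.of_forall fun y => ?_)
  simp only [mul_assoc, integral_const_mul]
  simp_rw [greenKernel_comm y, integral_greenKernel_mul_eigenfunction]
  ring

/-! ### Dyadic intervals and the one-dimensional Haar factors -/

/-- The indicator function of the dyadic interval `[2^{-l} a, 2^{-l} (a + 1))`. -/
def cell (l a : ℕ) (t : ℝ) : ℝ := (Set.Ico (a : ℝ) (a + 1)).indicator 1 (2 ^ l * t)

theorem cell_eq_ite (l a : ℕ) (t : ℝ) :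
    cell l a t = if (a : ℝ) ≤ 2 ^ l * t ∧ 2 ^ l * t < a + 1 then 1 else 0 := by
  simp [cell, Set.indicator_apply]

theorem cell_nonneg (l a : ℕ) (t : ℝ) : 0 ≤ cell l a t := by
  rw [cell_eq_ite]; split_ifs <;> norm_num

theorem cell_le_one (l a : ℕ) (t : ℝ) : cell l a t ≤ 1 := by
  rw [cell_eq_ite]; split_ifs <;> norm_num

theorem measurable_cell (l a : ℕ) : Measurable (cell l a) :=
  (measurable_one.indicator measurableSet_Ico).comp (measurable_const_mul _)

theorem cell_split (l a : ℕ) (t : ℝ) :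
    cell l a t = cell (l + 1) (2 * a) t + cell (l + 1) (2 * a + 1) t := by
  simp only [cell_eq_ite, pow_succ]
  rw [show (2 : ℝ) ^ l * 2 * t = 2 * (2 ^ l * t) by ring]
  generalize (2 : ℝ) ^ l * t = r
  push_cast
  grind

theorem haarFactor_zero_eq (l a : ℕ) (t : ℝ) :
    haarFactor l a 0 t = (2 : ℝ) ^ ((l : ℝ) / 2) * cell l a t := by
  simp [haarFactor, cell]

theorem haarFactor_one_eq (l a : ℕ) (t : ℝ) :
    haarFactor l a 1 t =
      (2 : ℝ) ^ ((l : ℝ) / 2) * (cell (l + 1) (2 * a) t - cell (l + 1) (2 * a + 1) t) := by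
  simp only [haarFactor, one_ne_zero, if_false, cell_eq_ite, pow_succ, Set.indicator_apply,
    Set.mem_Ico, Pi.one_apply]
  push_cast
  congr 1
  congr 1 <;> refine if_congr ?_ rfl rfl <;> constructor <;> rintro ⟨h1, h2⟩ <;> constructor <;>
    linarith

theorem two_rpow_half_mul_self (l : ℕ) :
    (2 : ℝ) ^ ((l : ℝ) / 2) * (2 : ℝ) ^ ((l : ℝ) / 2) = 2 ^ l := by
  rw [← Real.rpow_add two_pos, add_halves, Real.rpow_natCast]

/-- The reproducing kernel of the functions on `[0, 1)` that are constant on the dyadic intervals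
of length `2^{-l}`. -/
def dyadicKernel (l : ℕ) (s t : ℝ) : ℝ :=
  2 ^ l * ∑ a ∈ Finset.range (2 ^ l), cell l a s * cell l a t

theorem sum_haarFactor_zero (l : ℕ) (s t : ℝ) :
    ∑ a : Fin (2 ^ l), haarFactor l a 0 s * haarFactor l a 0 t = dyadicKernel l s t := by
  rw [Fin.sum_univ_eq_sum_range (fun a => haarFactor l a 0 s * haarFactor l a 0 t), dyadicKernel,
    Finset.mul_sum]
  refine Finset.sum_congr rfl fun a _ => ?_
  rw [haarFactor_zero_eq, haarFactor_zero_eq, ← two_rpow_half_mul_self]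
  ring

theorem sum_range_two_mul (f : ℕ → ℝ) (n : ℕ) :
    ∑ a ∈ Finset.range (2 * n), f a = ∑ a ∈ Finset.range n, (f (2 * a) + f (2 * a + 1)) := by
  induction n with
  | zero => simp
  | succ n ih =>
    rw [mul_add, mul_one, Finset.sum_range_succ, Finset.sum_range_succ, ih, Finset.sum_range_succ]
    ring

/-- The two-scale relation: both Haar factors together refine the dyadic intervals. -/
theorem sum_haarFactor (l : ℕ) (s t : ℝ) :
    ∑ b : Fin 2, ∑ a : Fin (2 ^ l), haarFactor l a b s * haarFactor l a b t =
      dyadicKernel (l + 1) s t := by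
  rw [Fin.sum_univ_two, sum_haarFactor_zero,
    Fin.sum_univ_eq_sum_range (fun a => haarFactor l a 1 s * haarFactor l a 1 t), dyadicKernel,
    dyadicKernel, show 2 ^ (l + 1) = 2 * 2 ^ l from pow_succ' 2 l, sum_range_two_mul,
    Finset.mul_sum, Finset.mul_sum, ← Finset.sum_add_distrib]
  refine Finset.sum_congr rfl fun a _ => ?_
  rw [haarFactor_one_eq, haarFactor_one_eq, cell_split l a s, cell_split l a t, pow_succ,
    ← two_rpow_half_mul_self]
  ring

theorem sum_cell (l : ℕ) {t : ℝ} (ht : t ∈ Set.Ico (0 : ℝ) 1) :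
    ∑ a ∈ Finset.range (2 ^ l), cell l a t = 1 := by
  have h0 : 0 ≤ 2 ^ l * t := by have := ht.1; positivity
  rw [Finset.sum_eq_single ⌊2 ^ l * t⌋₊]
  · rw [cell_eq_ite, if_pos ⟨Nat.floor_le h0, Nat.lt_floor_add_one _⟩]
  · intro a _ ha
    rw [cell_eq_ite, if_neg]
    rintro ⟨h1, h2⟩
    exact ha ((Nat.floor_eq_iff h0).mpr ⟨h1, h2⟩).symm
  · intro h
    exfalso
    apply h
    rw [Finset.mem_range, Nat.floor_lt h0]
    push_cast
    have h2 : (0 : ℝ) < 2 ^ l := by positivity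
    nlinarith [ht.2]

theorem dyadicKernel_nonneg (l : ℕ) (s t : ℝ) : 0 ≤ dyadicKernel l s t :=
  mul_nonneg (by positivity)
    (Finset.sum_nonneg fun a _ => mul_nonneg (cell_nonneg l a s) (cell_nonneg l a t))

theorem dyadicKernel_comm (l : ℕ) (s t : ℝ) : dyadicKernel l s t = dyadicKernel l t s := by
  simp only [dyadicKernel, mul_comm]

theorem dyadicKernel_le (l : ℕ) {s : ℝ} (hs : s ∈ Set.Ico (0 : ℝ) 1) (t : ℝ) :
    dyadicKernel l s t ≤ 2 ^ l := by
  refine mul_le_of_le_one_right (by positivity) ?_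
  rw [← sum_cell l hs]
  exact Finset.sum_le_sum fun a _ => mul_le_of_le_one_right (cell_nonneg l a s) (cell_le_one l a t)

theorem dyadicKernel_zero {s t : ℝ} (hs : s ∈ Set.Ico (0 : ℝ) 1) (ht : t ∈ Set.Ico (0 : ℝ) 1) :
    dyadicKernel 0 s t = 1 := by
  have h1 := sum_cell 0 hs
  have h2 := sum_cell 0 ht
  simp only [pow_zero, Finset.range_one, Finset.sum_singleton] at h1 h2
  simp [dyadicKernel, h1, h2]

theorem abs_sub_le_of_dyadicKernel_ne_zero {l : ℕ} {s t : ℝ} (h : dyadicKernel l s t ≠ 0) :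
    |s - t| ≤ (1 / 2) ^ l := by
  obtain ⟨a, -, ha⟩ := Finset.exists_ne_zero_of_sum_ne_zero (right_ne_zero_of_mul h)
  have hs := left_ne_zero_of_mul ha
  have ht := right_ne_zero_of_mul ha
  rw [cell_eq_ite] at hs ht
  have hs' : (a : ℝ) ≤ 2 ^ l * s ∧ 2 ^ l * s < a + 1 := by
    by_contra h; exact hs (if_neg h)
  have ht' : (a : ℝ) ≤ 2 ^ l * t ∧ 2 ^ l * t < a + 1 := by
    by_contra h; exact ht (if_neg h)
  rw [one_div, inv_pow, inv_eq_one_div, le_div_iff₀ (by positivity),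
    ← abs_of_pos (show (0 : ℝ) < 2 ^ l by positivity), ← abs_mul, abs_le]
  constructor <;> linarith [hs'.1, hs'.2, ht'.1, ht'.2]

theorem rep_mem (x : UnitAddCircle) : rep x ∈ Set.Ico (0 : ℝ) 1 := by
  simpa [rep] using (AddCircle.equivIco (1 : ℝ) 0 x).2

theorem coe_rep (x : UnitAddCircle) : ((rep x : ℝ) : UnitAddCircle) = x :=
  AddCircle.coe_equivIco

theorem measurable_rep : Measurable rep :=
  measurable_subtype_coe.comp (AddCircle.measurableEquivIco (1 : ℝ) 0).measurable

theorem integral_comp_rep (f : ℝ → ℝ) :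
    ∫ x : UnitAddCircle, f (rep x) = ∫ t in Set.Ico (0 : ℝ) 1, f t := by
  rw [← AddCircle.integral_preimage 1 0, integral_Ico_eq_integral_Ioo, zero_add,
    integral_Ioc_eq_integral_Ioo]
  refine setIntegral_congr_fun measurableSet_Ioo fun t ht => ?_
  have : rep (t : UnitAddCircle) = t :=
    AddCircle.equivIco_coe_of_mem (by simpa using Set.Ioo_subset_Ico_self ht)
  simp only [this]

theorem integral_cell {l a : ℕ} (ha : a < 2 ^ l) :
    ∫ x : UnitAddCircle, cell l a (rep x) = (2 ^ l)⁻¹ := by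
  have h2 : (0 : ℝ) < 2 ^ l := by positivity
  have ha' : (a : ℝ) + 1 ≤ 2 ^ l := by exact_mod_cast ha
  have h1 : cell l a = (Set.Ico (a / 2 ^ l : ℝ) ((a + 1) / 2 ^ l)).indicator 1 := by
    funext t
    simp only [cell_eq_ite, Set.indicator_apply, Set.mem_Ico, div_le_iff₀' h2, lt_div_iff₀' h2,
      Pi.one_apply]
  rw [integral_comp_rep, h1, setIntegral_indicator measurableSet_Ico,
    Set.inter_eq_self_of_subset_right]
  · simp only [Pi.one_apply, integral_const, MeasurableSet.univ, measureReal_restrict_apply,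
      Set.univ_inter, smul_eq_mul, mul_one]
    rw [Real.volume_real_Ico_of_le (by gcongr; linarith)]
    field_simp; ring
  · refine Set.Ico_subset_Ico (by positivity) ?_
    rwa [div_le_one h2]

theorem measurable_dyadicKernel (l : ℕ) :
    Measurable fun p : ℝ × ℝ => dyadicKernel l p.1 p.2 := by
  unfold dyadicKernel
  refine measurable_const.mul (Finset.measurable_sum _ fun a _ => ?_)
  exact ((measurable_cell l a).comp measurable_fst).mul ((measurable_cell l a).comp measurable_snd)

theorem integral_dyadicKernel (l : ℕ) {s : ℝ} (hs : s ∈ Set.Ico (0 : ℝ) 1) :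
    ∫ y : UnitAddCircle, dyadicKernel l s (rep y) = 1 := by
  have hint : ∀ a, Integrable (fun y : UnitAddCircle => cell l a (rep y)) volume := fun a =>
    Integrable.of_bound ((measurable_cell l a).comp measurable_rep).aestronglyMeasurable 1
      (Eventually.of_forall fun y => by
        rw [Real.norm_of_nonneg (cell_nonneg _ _ _)]; exact cell_le_one _ _ _)
  unfold dyadicKernel
  rw [integral_const_mul, integral_finsetSum _ fun a _ => (hint a).const_mul _]
  simp_rw [integral_const_mul]
  rw [Finset.sum_congr rfl fun a ha => by rw [integral_cell (Finset.mem_range.mp ha)],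
    ← Finset.sum_mul, sum_cell l hs, one_mul]
  exact mul_inv_cancel₀ (by positivity)

/-! ### The Haar system is a Parseval frame of the mean-zero functions -/

theorem eLpNorm_two_eq {α : Type*} [MeasurableSpace α] {μ : Measure α} {f : α → ℝ}
    (hf : MemLp f 2 μ) : eLpNorm f 2 μ = ENNReal.ofReal (Real.sqrt (∫ x, f x ^ 2 ∂μ)) := by
  rw [hf.eLpNorm_eq_integral_rpow_norm (by simp) (by simp), Real.sqrt_eq_rpow]
  simp

/-- The reproducing kernel of the functions on the torus that are constant on the dyadic cubes of
side `2^{-l}`: it is `2^{4l}` if `x` and `y` lie in the same cube, and `0` otherwise. -/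
def cubeKernel (l : ℕ) (x y : T4) : ℝ := ∏ j, dyadicKernel l (rep (x j)) (rep (y j))

theorem cubeKernel_nonneg (l : ℕ) (x y : T4) : 0 ≤ cubeKernel l x y :=
  Finset.prod_nonneg fun _ _ => dyadicKernel_nonneg _ _ _

theorem cubeKernel_comm (l : ℕ) (x y : T4) : cubeKernel l x y = cubeKernel l y x :=
  Finset.prod_congr rfl fun _ _ => dyadicKernel_comm _ _ _

theorem cubeKernel_zero (x y : T4) : cubeKernel 0 x y = 1 :=
  Finset.prod_eq_one fun _ _ => dyadicKernel_zero (rep_mem _) (rep_mem _)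

theorem cubeKernel_le (l : ℕ) (x y : T4) : cubeKernel l x y ≤ (2 ^ l) ^ 4 :=
  (Finset.prod_le_prod (fun _ _ => dyadicKernel_nonneg _ _ _)
    fun j _ => dyadicKernel_le l (rep_mem (x j)) (rep (y j))).trans_eq (by simp)

theorem measurable_cubeKernel (l : ℕ) : Measurable fun p : T4 × T4 => cubeKernel l p.1 p.2 := by
  unfold cubeKernel
  refine Finset.measurable_prod _ fun j _ => ?_
  have h1 : Measurable fun p : T4 × T4 => rep (p.1 j) := measurable_rep.comp (by fun_prop)
  have h2 : Measurable fun p : T4 × T4 => rep (p.2 j) := measurable_rep.comp (by fun_prop)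
  exact Measurable.comp (g := fun q : ℝ × ℝ => dyadicKernel l q.1 q.2)
    (f := fun p : T4 × T4 => (rep (p.1 j), rep (p.2 j))) (measurable_dyadicKernel l)
    (h1.prodMk h2)

theorem integral_cubeKernel (l : ℕ) (x : T4) : ∫ y, cubeKernel l x y = 1 := by
  have h : ∫ y, cubeKernel l x y = ∏ j, ∫ t : UnitAddCircle, dyadicKernel l (rep (x j)) (rep t) :=
    integral_fintype_prod_volume_eq_prod fun j t => dyadicKernel l (rep (x j)) (rep t)
  rw [h]
  exact Finset.prod_eq_one fun j _ => integral_dyadicKernel l (rep_mem _)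

theorem dist_le_of_cubeKernel_ne_zero {l : ℕ} {x y : T4} (h : cubeKernel l x y ≠ 0) :
    dist x y ≤ (1 / 2) ^ l := by
  rw [dist_pi_le_iff (by positivity)]
  intro j
  have h1 := abs_sub_le_of_dyadicKernel_ne_zero (Finset.prod_ne_zero_iff.mp h j (Finset.mem_univ j))
  refine le_trans ?_ h1
  conv_lhs => rw [← coe_rep (x j), ← coe_rep (y j)]
  rw [dist_eq_norm, ← AddCircle.coe_sub]
  exact QuotientAddGroup.norm_mk_le_norm

/-- Summing over the Haar functions of one level telescopes. The type `β = 0`, which is excluded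
from the index set, contributes the kernel of the coarser level. -/
theorem sum_haar_mul_haar (l : ℕ) (x y : T4) :
    ∑ i : HaarIndex l, haar l i x * haar l i y = cubeKernel (l + 1) x y - cubeKernel l x y := by
  have h1 : ∀ b : Fin 4 → Fin 2, ∑ a : CubeIndex l,
      ∏ j, (haarFactor l (a j) (b j) (rep (x j)) * haarFactor l (a j) (b j) (rep (y j))) =
      ∏ j, ∑ a : Fin (2 ^ l),
        haarFactor l a (b j) (rep (x j)) * haarFactor l a (b j) (rep (y j)) := fun b =>
    (Fintype.prod_sum fun j (a : Fin (2 ^ l)) =>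
        haarFactor l a (b j) (rep (x j)) * haarFactor l a (b j) (rep (y j))).symm
  have h2 : ∑ b : Fin 4 → Fin 2, ∏ j, ∑ a : Fin (2 ^ l),
        haarFactor l a (b j) (rep (x j)) * haarFactor l a (b j) (rep (y j)) =
      cubeKernel (l + 1) x y := by
    have := Fintype.prod_sum fun j (b : Fin 2) => ∑ a : Fin (2 ^ l),
        haarFactor l a b (rep (x j)) * haarFactor l a b (rep (y j))
    rw [← this]
    exact Finset.prod_congr rfl fun j _ => sum_haarFactor _ _ _
  rw [Fintype.sum_eq_add_sum_subtype_ne _ 0] at h2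
  have h3 : ∏ j : Fin 4, ∑ a : Fin (2 ^ l), haarFactor l a ((0 : Fin 4 → Fin 2) j) (rep (x j)) *
      haarFactor l a ((0 : Fin 4 → Fin 2) j) (rep (y j)) = cubeKernel l x y :=
    Finset.prod_congr rfl fun j _ => sum_haarFactor_zero _ _ _
  rw [h3] at h2
  rw [← h2, add_sub_cancel_left, Fintype.sum_prod_type_right]
  refine Finset.sum_congr rfl fun b _ => ?_
  rw [← h1]
  refine Finset.sum_congr rfl fun a _ => ?_
  rw [haar, haar, ← Finset.prod_mul_distrib]

theorem measurable_haar (l : ℕ) (i : HaarIndex l) : Measurable (haar l i) := by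
  unfold haar
  refine Finset.measurable_prod _ fun j _ => ?_
  refine Measurable.comp (g := haarFactor l (i.1 j) (i.2.1 j)) ?_
    (measurable_rep.comp (measurable_pi_apply j))
  generalize i.2.1 j = b
  fin_cases b
  · exact (funext (haarFactor_zero_eq l (i.1 j))) ▸ (measurable_cell _ _).const_mul _
  · exact (funext (haarFactor_one_eq l (i.1 j))) ▸
      ((measurable_cell _ _).sub (measurable_cell _ _)).const_mul _

theorem abs_haar_le (l : ℕ) (i : HaarIndex l) (x : T4) : |haar l i x| ≤ (2 ^ (l + 1)) ^ 4 := by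
  have h : haar l i x * haar l i x ≤ (2 ^ (l + 1)) ^ 4 := by
    refine (Finset.single_le_sum (f := fun i => haar l i x * haar l i x)
      (fun i _ => mul_self_nonneg _) (Finset.mem_univ i)).trans ?_
    rw [sum_haar_mul_haar]
    linarith [cubeKernel_nonneg l x x, cubeKernel_le (l + 1) x x]
  have h1 : (1 : ℝ) ≤ (2 ^ (l + 1)) ^ 4 := one_le_pow₀ (one_le_pow₀ one_le_two)
  rw [← abs_mul_abs_self] at h
  nlinarith [abs_nonneg (haar l i x)]

theorem memLp_haar (l : ℕ) (i : HaarIndex l) (p : ℝ≥0∞) : MemLp (haar l i) p volume :=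
  MemLp.of_bound (measurable_haar l i).aestronglyMeasurable _
    (Eventually.of_forall fun x => abs_haar_le l i x)

theorem integrable_mul_cubeKernel (l : ℕ) {f : T4 × T4 → ℝ}
    (hf : Integrable f (volume.prod volume)) :
    Integrable (fun p : T4 × T4 => f p * cubeKernel l p.1 p.2) (volume.prod volume) :=
  hf.mul_bdd (c := (2 ^ l) ^ 4) (measurable_cubeKernel l).aestronglyMeasurable
    (Eventually.of_forall fun p => by
      rw [Real.norm_of_nonneg (cubeKernel_nonneg _ _ _)]; exact cubeKernel_le _ _ _)

/-- Partial sums of squared Haar coefficients. -/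
theorem sum_sq_integral_haar {w : T4 → ℝ} (hw : Integrable w volume) (l : ℕ) :
    ∑ κ ∈ Finset.range l, ∑ i : HaarIndex κ, (∫ x, haar κ i x * w x) ^ 2 =
      (∫ p : T4 × T4, w p.1 * w p.2 * cubeKernel l p.1 p.2 ∂(volume.prod volume)) -
        (∫ x, w x) ^ 2 := by
  have hww : Integrable (fun p : T4 × T4 => w p.1 * w p.2) (volume.prod volume) := hw.mul_prod hw
  induction l with
  | zero =>
    simp only [Finset.range_zero, Finset.sum_empty, cubeKernel_zero, mul_one]
    rw [integral_prod_mul]; ring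
  | succ l ih =>
    rw [Finset.sum_range_succ, ih]
    have h1 : ∀ i : HaarIndex l, (∫ x, haar l i x * w x) ^ 2 =
        ∫ p : T4 × T4, (haar l i p.1 * w p.1) * (haar l i p.2 * w p.2) ∂(volume.prod volume) :=
      fun i => by
        rw [integral_prod_mul (fun x => haar l i x * w x) (fun x => haar l i x * w x), sq]
    have hi : ∀ i : HaarIndex l, Integrable (fun x => haar l i x * w x) volume := fun i =>
      hw.bdd_mul (measurable_haar l i).aestronglyMeasurable
        (Eventually.of_forall fun x => abs_haar_le l i x)
    simp_rw [h1]
    rw [← integral_finsetSum _ fun i _ => (hi i).mul_prod (hi i)]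
    have h2 : ∀ p : T4 × T4, ∑ i : HaarIndex l, (haar l i p.1 * w p.1) * (haar l i p.2 * w p.2) =
        w p.1 * w p.2 * cubeKernel (l + 1) p.1 p.2 - w p.1 * w p.2 * cubeKernel l p.1 p.2 :=
      fun p => by
        rw [← mul_sub, ← sum_haar_mul_haar, Finset.mul_sum]
        exact Finset.sum_congr rfl fun i _ => by ring
    simp_rw [h2]
    rw [integral_sub (integrable_mul_cubeKernel _ hww) (integrable_mul_cubeKernel _ hww)]
    ring

/-- The squared `L²` distance from `w` to its average over dyadic cubes of side `2^{-l}`. -/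
def cubeDefect (l : ℕ) (w : T4 → ℝ) : ℝ :=
  2⁻¹ * ∫ p : T4 × T4, (w p.1 - w p.2) ^ 2 * cubeKernel l p.1 p.2 ∂(volume.prod volume)

theorem cubeDefect_nonneg (l : ℕ) (w : T4 → ℝ) : 0 ≤ cubeDefect l w :=
  mul_nonneg (by norm_num)
    (integral_nonneg fun _ => mul_nonneg (sq_nonneg _) (cubeKernel_nonneg _ _ _))

section Defect

variable {w : T4 → ℝ}

theorem integrable_sq_fst (hw : MemLp w 2 volume) :
    Integrable (fun p : T4 × T4 => w p.1 ^ 2) (volume.prod volume) :=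
  hw.integrable_sq.comp_fst volume

theorem integrable_sq_snd (hw : MemLp w 2 volume) :
    Integrable (fun p : T4 × T4 => w p.2 ^ 2) (volume.prod volume) :=
  hw.integrable_sq.comp_snd volume

theorem integrable_mul_fst_snd (hw : MemLp w 2 volume) :
    Integrable (fun p : T4 × T4 => w p.1 * w p.2) (volume.prod volume) :=
  (hw.integrable one_le_two).mul_prod (hw.integrable one_le_two)

theorem integrable_sub_sq (hw : MemLp w 2 volume) :
    Integrable (fun p : T4 × T4 => (w p.1 - w p.2) ^ 2) (volume.prod volume) := by
  have := ((integrable_sq_fst hw).add (integrable_sq_snd hw)).sub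
    ((integrable_mul_fst_snd hw).const_mul 2)
  refine this.congr (Eventually.of_forall fun p => ?_)
  simp only [Pi.sub_apply, Pi.add_apply]
  ring

theorem integral_sq_fst_mul_cubeKernel (hw : MemLp w 2 volume) (l : ℕ) :
    ∫ p : T4 × T4, w p.1 ^ 2 * cubeKernel l p.1 p.2 ∂(volume.prod volume) = ∫ x, w x ^ 2 := by
  rw [integral_prod _ (integrable_mul_cubeKernel l (integrable_sq_fst hw))]
  simp_rw [integral_const_mul, integral_cubeKernel, mul_one]

theorem integral_sq_snd_mul_cubeKernel (hw : MemLp w 2 volume) (l : ℕ) :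
    ∫ p : T4 × T4, w p.2 ^ 2 * cubeKernel l p.1 p.2 ∂(volume.prod volume) = ∫ x, w x ^ 2 := by
  rw [integral_prod_symm _ (integrable_mul_cubeKernel l (integrable_sq_snd hw))]
  simp_rw [integral_const_mul, cubeKernel_comm l _ _, integral_cubeKernel, mul_one]

theorem cubeDefect_eq (hw : MemLp w 2 volume) (l : ℕ) :
    cubeDefect l w = (∫ x, w x ^ 2) -
      ∫ p : T4 × T4, w p.1 * w p.2 * cubeKernel l p.1 p.2 ∂(volume.prod volume) := by
  have h1 := integrable_mul_cubeKernel l (integrable_sq_fst hw)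
  have h2 := integrable_mul_cubeKernel l (integrable_sq_snd hw)
  have h3 := integrable_mul_cubeKernel l (integrable_mul_fst_snd hw)
  have h : ∀ p : T4 × T4, (w p.1 - w p.2) ^ 2 * cubeKernel l p.1 p.2 =
      w p.1 ^ 2 * cubeKernel l p.1 p.2 + w p.2 ^ 2 * cubeKernel l p.1 p.2 -
        2 * (w p.1 * w p.2 * cubeKernel l p.1 p.2) := fun p => by ring
  unfold cubeDefect
  simp_rw [h]
  rw [integral_sub (f := fun p : T4 × T4 => w p.1 ^ 2 * cubeKernel l p.1 p.2 +
    w p.2 ^ 2 * cubeKernel l p.1 p.2) (h1.add h2) (h3.const_mul 2), integral_add h1 h2,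
    integral_const_mul,
    integral_sq_fst_mul_cubeKernel hw, integral_sq_snd_mul_cubeKernel hw]
  ring

theorem cubeDefect_le (hw : MemLp w 2 volume) (l : ℕ) :
    cubeDefect l w ≤ 2 * ∫ x, w x ^ 2 := by
  have h1 := integrable_mul_cubeKernel l (integrable_sq_fst hw)
  have h2 := integrable_mul_cubeKernel l (integrable_sq_snd hw)
  have h4 := integrable_mul_cubeKernel l (integrable_sub_sq hw)
  have h : ∫ p : T4 × T4, (w p.1 - w p.2) ^ 2 * cubeKernel l p.1 p.2 ∂(volume.prod volume) ≤
      ∫ p : T4 × T4, (2 * (w p.1 ^ 2 * cubeKernel l p.1 p.2) +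
        2 * (w p.2 ^ 2 * cubeKernel l p.1 p.2)) ∂(volume.prod volume) := by
    refine integral_mono h4 ((h1.const_mul 2).add (h2.const_mul 2)) fun p => ?_
    have := cubeKernel_nonneg l p.1 p.2
    nlinarith [mul_nonneg (sq_nonneg (w p.1 + w p.2)) this]
  rw [integral_add (h1.const_mul 2) (h2.const_mul 2), integral_const_mul, integral_const_mul,
    integral_sq_fst_mul_cubeKernel hw, integral_sq_snd_mul_cubeKernel hw] at h
  unfold cubeDefect
  linarith

theorem cubeDefect_le_add {f : T4 → ℝ} (hw : MemLp w 2 volume) (hf : MemLp f 2 volume) (l : ℕ) :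
    cubeDefect l w ≤ 2 * cubeDefect l (w - f) + 2 * cubeDefect l f := by
  have h1 := integrable_mul_cubeKernel l (integrable_sub_sq (hw.sub hf))
  have h2 := integrable_mul_cubeKernel l (integrable_sub_sq hf)
  have h4 := integrable_mul_cubeKernel l (integrable_sub_sq hw)
  have h : ∫ p : T4 × T4, (w p.1 - w p.2) ^ 2 * cubeKernel l p.1 p.2 ∂(volume.prod volume) ≤
      ∫ p : T4 × T4, (2 * (((w - f) p.1 - (w - f) p.2) ^ 2 * cubeKernel l p.1 p.2) +
        2 * ((f p.1 - f p.2) ^ 2 * cubeKernel l p.1 p.2)) ∂(volume.prod volume) := by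
    refine integral_mono h4 ((h1.const_mul 2).add (h2.const_mul 2)) fun p => ?_
    have := cubeKernel_nonneg l p.1 p.2
    simp only [Pi.sub_apply]
    nlinarith [mul_nonneg (sq_nonneg ((w p.1 - w p.2) - 2 * (f p.1 - f p.2))) this]
  rw [integral_add (h1.const_mul 2) (h2.const_mul 2), integral_const_mul, integral_const_mul] at h
  unfold cubeDefect
  linarith

/-- Continuous functions oscillate little on small cubes. -/
theorem tendsto_cubeDefect_of_continuous {f : T4 → ℝ} (hf : Continuous f) :
    Tendsto (fun l => cubeDefect l f) atTop (𝓝 0) := by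
  have hfm : MemLp f 2 volume := by
    obtain ⟨C, hC⟩ := isCompact_univ.exists_bound_of_continuousOn hf.continuousOn
    exact MemLp.of_bound hf.aestronglyMeasurable C (Eventually.of_forall fun x => hC x trivial)
  rw [Metric.tendsto_atTop]
  intro ε hε
  have huc := Metric.uniformContinuous_iff.mp (CompactSpace.uniformContinuous_of_continuous hf)
  obtain ⟨δ, hδ, h⟩ := huc (Real.sqrt ε) (by positivity)
  obtain ⟨N, hN⟩ := exists_pow_lt_of_lt_one hδ (show (1 / 2 : ℝ) < 1 by norm_num)
  refine ⟨N, fun l hl => ?_⟩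
  have hl' : (1 / 2 : ℝ) ^ l < δ :=
    (pow_le_pow_of_le_one (by norm_num) (by norm_num) hl).trans_lt hN
  rw [Real.dist_eq, sub_zero, abs_of_nonneg (cubeDefect_nonneg _ _)]
  have h1 : Integrable (fun p : T4 × T4 => ε * cubeKernel l p.1 p.2) (volume.prod volume) :=
    integrable_mul_cubeKernel l (integrable_const ε)
  have h2 : ∫ p : T4 × T4, (f p.1 - f p.2) ^ 2 * cubeKernel l p.1 p.2 ∂(volume.prod volume) ≤
      ∫ p : T4 × T4, ε * cubeKernel l p.1 p.2 ∂(volume.prod volume) := by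
    refine integral_mono (integrable_mul_cubeKernel l (integrable_sub_sq hfm)) h1 fun p => ?_
    by_cases hK : cubeKernel l p.1 p.2 = 0
    · simp [hK]
    · refine mul_le_mul_of_nonneg_right ?_ (cubeKernel_nonneg _ _ _)
      have h3 := h ((dist_le_of_cubeKernel_ne_zero hK).trans_lt hl')
      rw [Real.dist_eq] at h3
      rw [← sq_abs, ← Real.sq_sqrt hε.le]
      exact pow_le_pow_left₀ (abs_nonneg _) h3.le 2
  have h4 : ∫ p : T4 × T4, ε * cubeKernel l p.1 p.2 ∂(volume.prod volume) = ε := by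
    rw [integral_prod _ h1]
    simp_rw [integral_const_mul, integral_cubeKernel]
    simp
  unfold cubeDefect
  linarith

/-- Dyadic averages converge in `L²`. -/
theorem tendsto_cubeDefect (hw : MemLp w 2 volume) :
    Tendsto (fun l => cubeDefect l w) atTop (𝓝 0) := by
  rw [Metric.tendsto_atTop]
  intro ε hε
  obtain ⟨f, hf1, hf2⟩ := hw.exists_boundedContinuous_eLpNorm_sub_le (by simp)
    (ε := ENNReal.ofReal (Real.sqrt (ε / 8))) (by simp; positivity)
  have hsub : MemLp (w - ⇑f) 2 volume := hw.sub hf2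
  have h1 : ∫ x, (w - ⇑f) x ^ 2 ≤ ε / 8 := by
    rw [eLpNorm_two_eq hsub, ENNReal.ofReal_le_ofReal_iff (by positivity)] at hf1
    exact (Real.sqrt_le_sqrt_iff (by positivity)).mp hf1
  obtain ⟨N, hN⟩ := Metric.tendsto_atTop.mp (tendsto_cubeDefect_of_continuous f.continuous) (ε / 4)
    (by positivity)
  refine ⟨N, fun l hl => ?_⟩
  have h2 := hN l hl
  rw [Real.dist_eq, sub_zero, abs_of_nonneg (cubeDefect_nonneg _ _)] at h2 ⊢
  have h3 := cubeDefect_le_add hw hf2 l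
  have h4 := cubeDefect_le hsub l
  linarith

end Defect

/-- The levels below `l` of the index set of the Haar system. -/
def levels (l : ℕ) : Finset (Σ κ, HaarIndex κ) := (Finset.range l).sigma fun _ => Finset.univ

theorem sum_levels (f : (Σ κ, HaarIndex κ) → ℝ) (l : ℕ) :
    ∑ j ∈ levels l, f j = ∑ κ ∈ Finset.range l, ∑ i : HaarIndex κ, f ⟨κ, i⟩ :=
  Finset.sum_sigma _ _ _

theorem mem_levels {l : ℕ} {j : Σ κ, HaarIndex κ} : j ∈ levels l ↔ j.1 < l := by
  simp [levels]

theorem tendsto_levels : Tendsto levels atTop atTop := by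
  refine tendsto_atTop_finset_of_monotone (fun a b hab j hj => ?_) fun j => ⟨j.1 + 1, ?_⟩
  · exact mem_levels.mpr ((mem_levels.mp hj).trans_le hab)
  · exact mem_levels.mpr (Nat.lt_succ_self _)

/-- Parseval's identity for the Haar system: it is a tight frame of the orthogonal complement of
the constants. Orthonormality of the system is not needed. -/
theorem hasSum_sq_integral_haar {w : T4 → ℝ} (hw : MemLp w 2 volume) :
    HasSum (fun j : Σ κ, HaarIndex κ => (∫ x, haar j.1 j.2 x * w x) ^ 2)
      ((∫ x, w x ^ 2) - (∫ x, w x) ^ 2) := by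
  have h1 : ∀ l, ∑ j ∈ levels l, (∫ x, haar j.1 j.2 x * w x) ^ 2 =
      (∫ x, w x ^ 2) - (∫ x, w x) ^ 2 - cubeDefect l w := fun l => by
    rw [sum_levels (fun j => (∫ x, haar j.1 j.2 x * w x) ^ 2),
      sum_sq_integral_haar (hw.integrable one_le_two), cubeDefect_eq hw]
    ring
  have hs : Summable fun j : Σ κ, HaarIndex κ => (∫ x, haar j.1 j.2 x * w x) ^ 2 := by
    refine summable_of_sum_le (c := (∫ x, w x ^ 2) - (∫ x, w x) ^ 2) (fun j => sq_nonneg _)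
      fun F => ?_
    obtain ⟨l, hl⟩ := (tendsto_levels.eventually_ge_atTop F).exists
    refine (Finset.sum_le_sum_of_subset_of_nonneg hl fun j _ _ => sq_nonneg _).trans ?_
    rw [h1]
    linarith [cubeDefect_nonneg l w]
  have h2 := hs.hasSum.comp tendsto_levels
  have h3 : Tendsto (fun l => (∫ x, w x ^ 2) - (∫ x, w x) ^ 2 - cubeDefect l w) atTop
      (𝓝 ((∫ x, w x ^ 2) - (∫ x, w x) ^ 2 - 0)) := (tendsto_cubeDefect hw).const_sub _
  rw [sub_zero] at h3
  have h4 := tendsto_nhds_unique (h2.congr h1) h3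
  exact h4 ▸ hs.hasSum

/-! ### The covariance kernel as an integral kernel -/

theorem integrable_mul_greenKernel_mul_greenKernel {f : T4 → ℝ} (hf : Integrable f volume) :
    Integrable (fun q : (T4 × T4) × T4 =>
      f q.1.2 * greenKernel q.1.2 q.2 * greenKernel q.2 q.1.1)
      ((volume.prod volume).prod volume) := by
  have h : Integrable (fun q : (T4 × T4) × T4 =>
      f q.1.1 * greenKernel q.1.1 q.1.2 * greenKernel q.1.2 q.2)
      ((volume.prod volume).prod volume) := by
    simp_rw [greenKernel_eq _ _]
    have := integrable_greenKernel_mul hf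
    simp_rw [greenKernel_eq] at this
    exact integrable_mul_translate (f := fun p : T4 × T4 => f p.1 * greenFun (p.1 - p.2))
      (φ := fun p => p.2) this integrable_greenFun measurable_snd
  have hmp : MeasurePreserving (fun q : (T4 × T4) × T4 => ((q.1.2, q.2), q.1.1))
      ((volume.prod volume).prod volume) ((volume.prod volume).prod volume) :=
    Measure.measurePreserving_swap.comp (measurePreserving_prodAssoc volume volume volume)
  exact (hmp.integrable_comp h.aestronglyMeasurable).mpr h

theorem integrable_mul_greenKernel_mul_greenKernel' {f : T4 → ℝ} (hf : Integrable f volume) :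
    Integrable (fun q : (T4 × T4) × T4 =>
      f q.1.1 * greenKernel q.1.1 q.2 * greenKernel q.2 q.1.2)
      ((volume.prod volume).prod volume) := by
  have h := integrable_mul_greenKernel_mul_greenKernel hf
  have hmp : MeasurePreserving (fun q : (T4 × T4) × T4 => ((q.1.2, q.1.1), q.2))
      ((volume.prod volume).prod volume) ((volume.prod volume).prod volume) :=
    Measure.measurePreserving_swap.prod (MeasurePreserving.id volume)
  exact (hmp.integrable_comp h.aestronglyMeasurable).mpr h

/-- Joint integrability of `u(x) G(x, z) G(z, y) v(y)`, from
`2 |u(x) v(y)| ≤ u(x)² + v(y)²` and the integrability of the Green kernel. -/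
theorem integrable_greenKernel_sandwich {u v : T4 → ℝ} (hu : MemLp u 2 volume)
    (hv : MemLp v 2 volume) :
    Integrable (fun q : (T4 × T4) × T4 =>
      (u q.1.1 * greenKernel q.1.1 q.2) * (greenKernel q.2 q.1.2 * v q.1.2))
      ((volume.prod volume).prod volume) := by
  have h1 := integrable_mul_greenKernel_mul_greenKernel' hu.integrable_sq
  have h2 := integrable_mul_greenKernel_mul_greenKernel hv.integrable_sq
  have h3 := (integrable_mul_greenKernel_mul_greenKernel'
    (hu.integrable one_le_two)).aestronglyMeasurable
  have h4 : AEStronglyMeasurable (fun q : (T4 × T4) × T4 => v q.1.2)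
      ((volume.prod volume).prod volume) := hv.aestronglyMeasurable.comp_snd.comp_fst
  refine Integrable.mono' (h1.norm.add h2.norm) ((h3.mul h4).congr
    (Eventually.of_forall fun q => by simp only [Pi.mul_apply]; ring))
    (Eventually.of_forall fun q => ?_)
  obtain ⟨⟨x, y⟩, z⟩ := q
  simp only [Pi.add_apply, Real.norm_eq_abs, abs_mul, abs_pow, sq_abs, greenKernel_comm y z,
    greenKernel_comm z x]
  have hG := mul_nonneg (abs_nonneg (greenKernel x z)) (abs_nonneg (greenKernel z y))
  nlinarith [sq_nonneg (|u x| - |v y|), sq_abs (u x), sq_abs (v y), sq_nonneg (u x),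
    sq_nonneg (v y), mul_nonneg hG (sq_nonneg (|u x| - |v y|)),
    mul_nonneg hG (sq_nonneg (u x)), mul_nonneg hG (sq_nonneg (v y))]

theorem integral_greenKernel_sandwich (u v : T4 → ℝ) (z : T4) :
    ∫ p : T4 × T4, (u p.1 * greenKernel p.1 z) * (greenKernel z p.2 * v p.2)
      ∂(volume.prod volume) = greenOp u z * greenOp v z := by
  rw [integral_prod_mul (fun x => u x * greenKernel x z) (fun y => greenKernel z y * v y),
    greenOp_eq u]
  rfl

theorem memLp_greenOp {u : T4 → ℝ} (hu : MemLp u 2 volume) : MemLp (greenOp u) 2 volume := by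
  rw [memLp_two_iff_integrable_sq
    (integrable_greenOp (hu.integrable one_le_two)).aestronglyMeasurable]
  refine (integrable_greenKernel_sandwich hu hu).integral_prod_right.congr
    (Eventually.of_forall fun z => ?_)
  simp only [integral_greenKernel_sandwich, sq]

theorem mul_covKernel_mul (u v : T4 → ℝ) (p : T4 × T4) :
    u p.1 * covKernel p.1 p.2 * v p.2 = 8 * Real.pi ^ 2 *
      ∫ z, (u p.1 * greenKernel p.1 z) * (greenKernel z p.2 * v p.2) := by
  have h : ∀ z, (u p.1 * greenKernel p.1 z) * (greenKernel z p.2 * v p.2) =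
      (u p.1 * v p.2) * (greenKernel p.1 z * greenKernel z p.2) := fun z => by ring
  simp_rw [h]
  rw [integral_const_mul, covKernel]
  ring

theorem integrable_mul_covKernel_mul {u v : T4 → ℝ} (hu : MemLp u 2 volume)
    (hv : MemLp v 2 volume) :
    Integrable (fun p : T4 × T4 => u p.1 * covKernel p.1 p.2 * v p.2) (volume.prod volume) := by
  simp_rw [mul_covKernel_mul]
  exact (integrable_greenKernel_sandwich hu hv).integral_prod_left.const_mul _

theorem covForm_eq (u v : FormalSeries) :
    covForm u v =
      8 * Real.pi ^ 2 * ∑' n, ((eigenvalue n)⁻¹ * u n) * ((eigenvalue n)⁻¹ * v n) := by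
  rw [covForm, ← tsum_mul_left]
  refine (tsum_subtype {n : Freq | n ≠ 0}
    fun n => (eigenvalue n ^ 2 / (8 * Real.pi ^ 2))⁻¹ * (u n * v n)).trans (tsum_congr fun n => ?_)
  by_cases hn : n = 0
  · simp [hn]
  · rw [Set.indicator_of_mem (by exact hn)]
    have := eigenvalue_pos hn
    field_simp

theorem integral_mul_covKernel_mul {u v : T4 → ℝ} (hu : MemLp u 2 volume)
    (hv : MemLp v 2 volume) :
    ∫ p : T4 × T4, u p.1 * covKernel p.1 p.2 * v p.2 ∂(volume.prod volume) =
      covForm (coeff u) (coeff v) := by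
  simp_rw [mul_covKernel_mul]
  rw [integral_const_mul, integral_integral_swap (integrable_greenKernel_sandwich hu hv),
    covForm_eq]
  simp_rw [integral_greenKernel_sandwich]
  rw [← (hasSum_coeff_mul_coeff (memLp_greenOp hu) (memLp_greenOp hv)).tsum_eq]
  simp_rw [coeff_greenOp (hu.integrable one_le_two), coeff_greenOp (hv.integrable one_le_two)]

/-! ### Sobolev spaces and the potential of a distribution in `H^{-2}` -/

theorem one_add_eigenvalue_pos (n : Freq) : 0 < 1 + eigenvalue n := by
  linarith [eigenvalue_nonneg n]

theorem mem_sobolev_iff {s : ℝ} {u : FormalSeries} :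
    u ∈ Sobolev s ↔ Summable fun n => (1 + eigenvalue n) ^ s * u n ^ 2 := by
  have h : ∀ n, 0 ≤ (1 + eigenvalue n) ^ s * u n ^ 2 := fun n =>
    mul_nonneg (Real.rpow_nonneg (one_add_eigenvalue_pos n).le _) (sq_nonneg _)
  constructor
  · intro hu
    have := ENNReal.summable_toReal (ne_of_lt hu)
    simpa only [ENNReal.toReal_ofReal (h _)] using this
  · intro hu
    exact hu.tsum_ofReal_lt_top

theorem sobolev_mono {s t : ℝ} (hst : s ≤ t) : Sobolev t ⊆ Sobolev s := by
  intro u hu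
  rw [mem_sobolev_iff] at hu ⊢
  refine Summable.of_nonneg_of_le (fun n => mul_nonneg
    (Real.rpow_nonneg (one_add_eigenvalue_pos n).le _) (sq_nonneg _)) (fun n => ?_) hu
  exact mul_le_mul_of_nonneg_right (Real.rpow_le_rpow_of_exponent_le
    (by linarith [eigenvalue_nonneg n]) hst) (sq_nonneg _)

theorem add_smul_mem_sobolev {s : ℝ} {u v : FormalSeries} (hu : u ∈ Sobolev s)
    (hv : v ∈ Sobolev s) (a b : ℝ) : a • u + b • v ∈ Sobolev s := by
  rw [mem_sobolev_iff] at *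
  refine Summable.of_nonneg_of_le (fun n => mul_nonneg
    (Real.rpow_nonneg (one_add_eigenvalue_pos n).le _) (sq_nonneg _)) (fun n => ?_)
    ((hu.mul_left (2 * a ^ 2)).add (hv.mul_left (2 * b ^ 2)))
  have h := Real.rpow_nonneg (one_add_eigenvalue_pos n).le s
  simp only [Pi.add_apply, Pi.smul_apply, smul_eq_mul]
  nlinarith [mul_nonneg h (sq_nonneg (a * u n - b * v n))]

theorem single_mem_sobolev (s : ℝ) (n : Freq) : (Pi.single n 1 : FormalSeries) ∈ Sobolev s := by
  rw [mem_sobolev_iff]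
  refine summable_of_ne_finset_zero (s := {n}) fun m hm => ?_
  rw [Pi.single_eq_of_ne (by simpa using hm)]
  simp

theorem coeff_mem_sobolev {u : T4 → ℝ} (hu : MemLp u 2 volume) {s : ℝ} (hs : s ≤ 0) :
    coeff u ∈ Sobolev s := by
  refine sobolev_mono hs (mem_sobolev_iff.mpr ?_)
  simpa [sq] using (hasSum_coeff_mul_coeff hu hu).summable

theorem inv_eigenvalue_sq_mul_le (n : Freq) (a : ℝ) :
    ((eigenvalue n)⁻¹ * a) ^ 2 ≤ 4 * ((1 + eigenvalue n) ^ (-2 : ℝ) * a ^ 2) := by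
  rw [mul_pow, inv_pow, ← mul_assoc]
  exact mul_le_mul_of_nonneg_right (inv_eigenvalue_sq_le n) (sq_nonneg _)

theorem memlp_potential {u : FormalSeries} (hu : u ∈ Sobolev (-2)) :
    Memℓp (fun n => (eigenvalue n)⁻¹ * u n) 2 := by
  refine memℓp_gen ?_
  have : Summable fun n => ((eigenvalue n)⁻¹ * u n) ^ 2 :=
    Summable.of_nonneg_of_le (fun n => sq_nonneg _)
      (fun n => inv_eigenvalue_sq_mul_le n (u n)) ((mem_sobolev_iff.mp hu).mul_left 4)
  convert this using 2 with n
  rw [ENNReal.toReal_ofNat, Real.rpow_two, Real.norm_eq_abs, sq_abs]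

open Classical in
/-- The potential `∑ n ≠ 0, λ_n⁻¹ u_n φ_n ∈ L²(𝕋⁴)` of `u ∈ H^{-2}`, that is, the grounded Green
operator applied to `u`. Outside `H^{-2}` the value is irrelevant. -/
def potential (u : FormalSeries) : L2T :=
  if h : Memℓp (fun n => (eigenvalue n)⁻¹ * u n) 2 then eigenBasis.repr.symm ⟨_, h⟩ else 0

theorem repr_potential {u : FormalSeries} (hu : u ∈ Sobolev (-2)) (n : Freq) :
    eigenBasis.repr (potential u) n = (eigenvalue n)⁻¹ * u n := by
  rw [potential, dif_pos (memlp_potential hu), LinearIsometryEquiv.apply_symm_apply]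

theorem coeff_potential {u : FormalSeries} (hu : u ∈ Sobolev (-2)) (n : Freq) :
    coeff (potential u) n = (eigenvalue n)⁻¹ * u n := by
  rw [← eigenBasis_repr, repr_potential hu]

theorem L2T_ext {f g : L2T} (h : ∀ n, eigenBasis.repr f n = eigenBasis.repr g n) : f = g :=
  eigenBasis.repr.injective (lp.ext (funext h))

theorem potential_add_smul {u v : FormalSeries} (hu : u ∈ Sobolev (-2)) (hv : v ∈ Sobolev (-2))
    (a b : ℝ) : potential (a • u + b • v) = a • potential u + b • potential v := by
  refine L2T_ext fun n => ?_
  have h := repr_potential (add_smul_mem_sobolev hu hv a b) n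
  have h1 := repr_potential hu n
  have h2 := repr_potential hv n
  rw [HilbertBasis.repr_apply_apply] at h1 h2
  rw [h, HilbertBasis.repr_apply_apply, inner_add_right, inner_smul_right, inner_smul_right, h1, h2]
  simp only [Pi.add_apply, Pi.smul_apply, smul_eq_mul]
  ring

theorem potential_single (n : Freq) :
    potential (Pi.single n 1) = (eigenvalue n)⁻¹ • eigenBasis n := by
  refine L2T_ext fun m => ?_
  rw [repr_potential (single_mem_sobolev _ n), map_smul, HilbertBasis.repr_self, lp.coeFn_smul,
    Pi.smul_apply, lp.single_apply, smul_eq_mul]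
  by_cases h : m = n
  · subst h; simp
  · simp [h]

theorem hasSum_potential {u : FormalSeries} (hu : u ∈ Sobolev (-2)) :
    HasSum (fun n => u n • potential (Pi.single n 1)) (potential u) := by
  refine (eigenBasis.hasSum_repr (potential u)).congr_fun fun n => ?_
  rw [repr_potential hu, potential_single, smul_smul, mul_comm]

theorem integral_potential {u : FormalSeries} (hu : u ∈ Sobolev (-2)) :
    ∫ x, potential u x = 0 := by
  have := coeff_potential hu 0
  simpa [coeff, eigenfunction_zero] using this

theorem covForm_eq_inner {u v : FormalSeries} (hu : u ∈ Sobolev (-2)) (hv : v ∈ Sobolev (-2)) :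
    covForm u v = 8 * Real.pi ^ 2 * inner ℝ (potential u) (potential v) := by
  rw [covForm_eq, inner_eq_integral,
    ← (hasSum_coeff_mul_coeff (Lp.memLp (potential u)) (Lp.memLp (potential v))).tsum_eq]
  simp_rw [coeff_potential hu, coeff_potential hv]

theorem covForm_single_self (n : Freq) :
    covForm (Pi.single n 1) (Pi.single n 1) = 8 * Real.pi ^ 2 * (eigenvalue n ^ 2)⁻¹ := by
  rw [covForm_eq_inner (single_mem_sobolev _ n) (single_mem_sobolev _ n), potential_single,
    inner_smul_left, inner_smul_right, real_inner_self_eq_norm_sq,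
    eigenBasis.orthonormal.norm_eq_one]
  simp [sq]

/-- The Haar functions as elements of `L²(𝕋⁴)`. -/
def haarLp (j : Σ κ, HaarIndex κ) : L2T := (memLp_haar j.1 j.2 2).toLp (haar j.1 j.2)

theorem inner_haarLp (j : Σ κ, HaarIndex κ) (w : L2T) :
    inner ℝ (haarLp j) w = ∫ x, haar j.1 j.2 x * w x := by
  rw [inner_eq_integral]
  refine integral_congr_ae ?_
  filter_upwards [(memLp_haar j.1 j.2 2).coeFn_toLp] with x h1
  rw [haarLp, h1]

theorem hasSum_sq_inner_haarLp (w : L2T) :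
    HasSum (fun j => inner ℝ (haarLp j) w ^ 2) (‖w‖ ^ 2 - (∫ x, w x) ^ 2) := by
  simp_rw [inner_haarLp]
  rw [← real_inner_self_eq_norm_sq, inner_eq_integral]
  simpa only [sq] using hasSum_sq_integral_haar (Lp.memLp w)

theorem hasSum_pairing_greenOp_haar {u : FormalSeries} (hu : u ∈ Sobolev (-2))
    (j : Σ κ, HaarIndex κ) :
    HasSum (fun n => u n * coeff (greenOp (haar j.1 j.2)) n)
      (inner ℝ (haarLp j) (potential u)) := by
  have hj := memLp_haar j.1 j.2 2
  rw [inner_haarLp]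
  refine (hasSum_coeff_mul_coeff hj (Lp.memLp (potential u))).congr_fun fun n => ?_
  rw [coeff_greenOp (hj.integrable one_le_two), coeff_potential hu]
  ring

section Field

variable {Ω : Type*} (ξ : (Σ κ, HaarIndex κ) → Ω → ℝ) (l : ℕ) (ω : Ω)

theorem hHat_eq_sum : hHat ξ l ω = fun x => ∑ j ∈ levels l,
    ξ j ω * (Real.sqrt 8 * Real.pi) * greenOp (haar j.1 j.2) x := by
  funext x
  rw [hHat, ← sum_levels (fun j => ξ j ω * greenOp (haar j.1 j.2) x), Finset.mul_sum]
  exact Finset.sum_congr rfl fun j _ => by ring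

theorem coeff_hHat (n : Freq) : coeff (hHat ξ l ω) n = ∑ j ∈ levels l,
    ξ j ω * (Real.sqrt 8 * Real.pi) * coeff (greenOp (haar j.1 j.2)) n := by
  have hint : ∀ j : Σ κ, HaarIndex κ,
      Integrable (fun x => greenOp (haar j.1 j.2) x * eigenfunction n x) volume := fun j =>
    (integrable_greenOp ((memLp_haar j.1 j.2 2).integrable one_le_two)).mul_bdd (c := 2)
      (by fun_prop) (Eventually.of_forall fun x => abs_eigenfunction_le n x)
  rw [hHat_eq_sum]
  unfold coeff
  simp_rw [Finset.sum_mul, mul_assoc _ _ (eigenfunction n _)]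
  rw [integral_finsetSum _ fun j _ => (hint j).const_mul _]
  simp_rw [integral_const_mul]

theorem hasSum_pairing_hHat {u : FormalSeries} (hu : u ∈ Sobolev (-2)) :
    HasSum (fun n => u n * coeff (hHat ξ l ω) n) (∑ j ∈ levels l,
      ξ j ω * (Real.sqrt 8 * Real.pi) * inner ℝ (haarLp j) (potential u)) := by
  refine (hasSum_sum fun j _ => (hasSum_pairing_greenOp_haar hu j).mul_left
    (ξ j ω * (Real.sqrt 8 * Real.pi))).congr_fun fun n => ?_
  rw [coeff_hHat, Finset.mul_sum]
  exact Finset.sum_congr rfl fun j _ => by ring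

theorem coeff_hHat_eq_pairing (n : Freq) : coeff (hHat ξ l ω) n = ∑ j ∈ levels l,
    ξ j ω * (Real.sqrt 8 * Real.pi) * inner ℝ (haarLp j) (potential (Pi.single n 1)) := by
  refine HasSum.unique ?_ (hasSum_pairing_hHat ξ l ω (single_mem_sobolev (-2) n))
  convert hasSum_single n fun m hm => ?_ using 1
  · simp
  · simp [Pi.single_eq_of_ne hm]

theorem coeff_hHat_mem_sobolev : coeff (hHat ξ l ω) ∈ Sobolev 2 := by
  have h1 : ∀ j : Σ κ, HaarIndex κ, coeff (greenOp (haar j.1 j.2)) ∈ Sobolev 2 := fun j => by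
    have hj := memLp_haar j.1 j.2 2
    have hs := (hasSum_coeff_mul_coeff hj hj).summable
    rw [mem_sobolev_iff]
    refine Summable.of_nonneg_of_le (fun n => mul_nonneg
      (Real.rpow_nonneg (one_add_eigenvalue_pos n).le _) (sq_nonneg _)) (fun n => ?_)
      (hs.mul_left 4)
    rw [coeff_greenOp (hj.integrable one_le_two)]
    refine (mul_le_mul_of_nonneg_left (inv_eigenvalue_sq_mul_le n _)
      (Real.rpow_nonneg (one_add_eigenvalue_pos n).le _)).trans_eq ?_
    rw [Real.rpow_neg (one_add_eigenvalue_pos n).le]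
    have := Real.rpow_pos_of_pos (one_add_eigenvalue_pos n) 2
    field_simp
  have h2 : ∀ F : Finset (Σ κ, HaarIndex κ), (fun n => ∑ j ∈ F,
      ξ j ω * (Real.sqrt 8 * Real.pi) * coeff (greenOp (haar j.1 j.2)) n) ∈ Sobolev 2 := by
    intro F
    classical
    induction F using Finset.induction_on with
    | empty => simp [mem_sobolev_iff]
    | insert j F hj ih =>
      convert add_smul_mem_sobolev (h1 j) ih (ξ j ω * (Real.sqrt 8 * Real.pi)) 1 using 1
      funext n
      simp [Finset.sum_insert hj]
  rw [show coeff (hHat ξ l ω) = _ from funext (coeff_hHat ξ l ω)]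
  exact h2 _

end Field

/-! ### Wiener integrals of square-summable coefficients -/

section Noise

variable {Ω : Type*} [mΩ : MeasurableSpace Ω] {P : Measure Ω}
  {ξ : (Σ κ, HaarIndex κ) → Ω → ℝ}

theorem memLp_of_hasLaw_gaussian {X : Ω → ℝ} (h : HasLaw X (gaussianReal 0 1) P) :
    MemLp X 2 P := by
  have h1 : MemLp id 2 (P.map X) := by
    rw [h.map_eq]; exact_mod_cast memLp_id_gaussianReal 2
  exact (memLp_map_measure_iff aestronglyMeasurable_id h.aemeasurable).mp h1

theorem integral_of_hasLaw_gaussian {X : Ω → ℝ} (h : HasLaw X (gaussianReal 0 1) P) :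
    ∫ ω, X ω ∂P = 0 := by
  rw [h.integral_eq, integral_id_gaussianReal]

theorem integral_sq_of_hasLaw_gaussian {X : Ω → ℝ} (h : HasLaw X (gaussianReal 0 1) P) :
    ∫ ω, X ω ^ 2 ∂P = 1 := by
  rw [← variance_of_integral_eq_zero h.aemeasurable (integral_of_hasLaw_gaussian h),
    h.variance_eq, variance_id_gaussianReal]
  rfl

/-- The white noise coefficients as elements of `L²(P)`. -/
def noiseLp (hlaw : ∀ j, HasLaw (ξ j) (gaussianReal 0 1) P) (j : Σ κ, HaarIndex κ) : Lp ℝ 2 P :=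
  (memLp_of_hasLaw_gaussian (hlaw j)).toLp (ξ j)

theorem orthonormal_noiseLp (hlaw : ∀ j, HasLaw (ξ j) (gaussianReal 0 1) P)
    (hindep : iIndepFun ξ P) : Orthonormal ℝ (noiseLp hlaw) := by
  classical
  rw [orthonormal_iff_ite]
  intro i j
  rw [noiseLp, noiseLp, inner_toLp]
  split_ifs with h
  · subst h
    simpa only [sq] using integral_sq_of_hasLaw_gaussian (hlaw i)
  · rw [(hindep.indepFun h).integral_fun_mul_eq_mul_integral
      (hlaw i).aemeasurable.aestronglyMeasurable (hlaw j).aemeasurable.aestronglyMeasurable,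
      integral_of_hasLaw_gaussian (hlaw i), zero_mul]

/-- The Wiener integral `c ↦ ∑ j, c_j ξ_j`, an isometry from `ℓ²` to `L²(P)`. -/
def noiseIntegral (hlaw : ∀ j, HasLaw (ξ j) (gaussianReal 0 1) P) (hindep : iIndepFun ξ P) :
    lp (fun _ : Σ κ, HaarIndex κ => ℝ) 2 →ₗᵢ[ℝ] Lp ℝ 2 P :=
  (orthonormal_noiseLp hlaw hindep).orthogonalFamily.linearIsometry

variable (hlaw : ∀ j, HasLaw (ξ j) (gaussianReal 0 1) P) (hindep : iIndepFun ξ P)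

theorem hasSum_noiseIntegral (c : lp (fun _ : Σ κ, HaarIndex κ => ℝ) 2) :
    HasSum (fun j => c j • noiseLp hlaw j) (noiseIntegral hlaw hindep c) := by
  simpa [noiseIntegral, LinearIsometry.toSpanSingleton_apply] using
    (orthonormal_noiseLp hlaw hindep).orthogonalFamily.hasSum_linearIsometry c

theorem coeFn_sum_smul_Lp {ι : Type*} (F : Finset ι) (c : ι → ℝ) (Y : ι → Lp ℝ 2 P) :
    ⇑(∑ j ∈ F, c j • Y j) =ᵐ[P] fun ω => ∑ j ∈ F, c j * Y j ω := by
  have h : ∀ᵐ ω ∂P, ∀ j ∈ F, (c j • Y j : Lp ℝ 2 P) ω = c j * Y j ω :=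
    (Finset.eventually_all F).mpr fun j _ => Lp.coeFn_smul (c j) (Y j)
  filter_upwards [Lp.coeFn_fun_finsetSum F fun j => c j • Y j, h] with ω h1 h2
  rw [h1]
  exact Finset.sum_congr rfl h2

theorem coeFn_sum_noiseLp (F : Finset (Σ κ, HaarIndex κ)) (c : (Σ κ, HaarIndex κ) → ℝ) :
    ⇑(∑ j ∈ F, c j • noiseLp hlaw j) =ᵐ[P] fun ω => ∑ j ∈ F, c j * ξ j ω := by
  have h : ∀ᵐ ω ∂P, ∀ j, noiseLp hlaw j ω = ξ j ω :=
    ae_all_iff.mpr fun j => (memLp_of_hasLaw_gaussian (hlaw j)).coeFn_toLp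
  filter_upwards [coeFn_sum_smul_Lp F c (noiseLp hlaw), h] with ω h1 h2
  rw [h1]
  simp only [h2]

theorem memLp_sum_noise (hlaw : ∀ j, HasLaw (ξ j) (gaussianReal 0 1) P)
    (F : Finset (Σ κ, HaarIndex κ)) (c : (Σ κ, HaarIndex κ) → ℝ) :
    MemLp (fun ω => ∑ j ∈ F, c j * ξ j ω) 2 P :=
  memLp_finsetSum F fun j _ => (memLp_of_hasLaw_gaussian (hlaw j)).const_mul (c j)

/-- Convergence of the partial sums over the levels to the Wiener integral. -/
theorem tendsto_eLpNorm_sum_noise_sub (c : lp (fun _ : Σ κ, HaarIndex κ => ℝ) 2) :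
    Tendsto (fun l => eLpNorm (fun ω => (∑ j ∈ levels l, c j * ξ j ω) -
      noiseIntegral hlaw hindep c ω) 2 P) atTop (𝓝 0) := by
  have h := ((Lp.tendsto_Lp_iff_tendsto_eLpNorm' _ _).mp
    (hasSum_noiseIntegral hlaw hindep c)).comp tendsto_levels
  refine h.congr fun l => eLpNorm_congr_ae ?_
  filter_upwards [coeFn_sum_noiseLp hlaw (levels l) c] with ω hω
  simp only [Pi.sub_apply, hω]

theorem integral_sum_noise (hlaw : ∀ j, HasLaw (ξ j) (gaussianReal 0 1) P)
    (F : Finset (Σ κ, HaarIndex κ)) (c : (Σ κ, HaarIndex κ) → ℝ) [IsFiniteMeasure P] :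
    ∫ ω, ∑ j ∈ F, c j * ξ j ω ∂P = 0 := by
  rw [integral_finsetSum _ fun j _ =>
    ((memLp_of_hasLaw_gaussian (hlaw j)).integrable one_le_two).const_mul _]
  exact Finset.sum_eq_zero fun j _ => by
    rw [integral_const_mul, integral_of_hasLaw_gaussian (hlaw j), mul_zero]

theorem charFun_sum_noise (hlaw : ∀ j, HasLaw (ξ j) (gaussianReal 0 1) P)
    (hindep : iIndepFun ξ P) (F : Finset (Σ κ, HaarIndex κ)) (c : (Σ κ, HaarIndex κ) → ℝ) (t : ℝ) :
    charFun (P.map fun ω => ∑ j ∈ F, c j * ξ j ω) t =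
      Complex.exp (-((∑ j ∈ F, c j ^ 2 : ℝ) : ℂ) * t ^ 2 / 2) := by
  have hi : iIndepFun (fun j ω => c j * ξ j ω) P :=
    hindep.comp (fun j x => c j * x) fun j => measurable_const_mul _
  have hF : iIndepFun (F.restrict fun j ω => c j * ξ j ω) P :=
    iIndepFun.precomp (g := fun j : F => (j : Σ κ, HaarIndex κ)) Subtype.val_injective hi
  rw [iIndepFun.charFun_map_fun_finsetSum_eq_prod
    (fun j _ => (hlaw j).aemeasurable.const_mul (c j)) hF, Finset.prod_apply]
  have h1 : ∀ j, charFun (P.map fun ω => c j * ξ j ω) t =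
      Complex.exp (-((c j ^ 2 : ℝ) : ℂ) * t ^ 2 / 2) := fun j => by
    have : P.map (fun ω => c j * ξ j ω) = (gaussianReal 0 1).map fun x => c j * x := by
      rw [← (hlaw j).map_eq, AEMeasurable.map_map_of_aemeasurable
        (measurable_const_mul _).aemeasurable (hlaw j).aemeasurable]
      rfl
    rw [this, gaussianReal_map_const_mul, charFun_gaussianReal]
    congr 1
    simp
    ring
  rw [Finset.prod_congr rfl fun j _ => h1 j, ← Complex.exp_sum]
  congr 1
  push_cast
  rw [← Finset.sum_neg_distrib, Finset.sum_mul, Finset.sum_div]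

variable [IsProbabilityMeasure P]

/-- Wiener integrals are Gaussian, as `L²` limits of Gaussian random variables. -/
theorem hasLaw_noiseIntegral (c : lp (fun _ : Σ κ, HaarIndex κ => ℝ) 2) :
    HasLaw (noiseIntegral hlaw hindep c) (gaussianReal 0 (‖c‖ ^ 2).toNNReal) P := by
  have hmeas : AEStronglyMeasurable (noiseIntegral hlaw hindep c) P := Lp.aestronglyMeasurable _
  refine ⟨hmeas.aemeasurable, ?_⟩
  have hm : ∀ l, AEStronglyMeasurable (fun ω => ∑ j ∈ levels l, c j * ξ j ω) P := fun l =>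
    (memLp_sum_noise hlaw (levels l) c).aestronglyMeasurable
  have hd := (tendstoInMeasure_of_tendsto_eLpNorm two_ne_zero hm hmeas
    (tendsto_eLpNorm_sum_noise_sub hlaw hindep c)).tendstoInDistribution
    fun l => (hm l).aemeasurable
  have : IsProbabilityMeasure (P.map (noiseIntegral hlaw hindep c)) :=
    Measure.isProbabilityMeasure_map hmeas.aemeasurable
  refine Measure.ext_of_charFun (funext fun t => ?_)
  have h1 := ProbabilityMeasure.tendsto_iff_tendsto_charFun.mp hd.tendsto t
  simp only [ProbabilityMeasure.coe_mk, charFun_sum_noise hlaw hindep] at h1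
  have h2 : Tendsto (fun l => ∑ j ∈ levels l, c j ^ 2) atTop (𝓝 (‖c‖ ^ 2)) := by
    have := lp.hasSum_norm (p := 2) (by simp) c
    simp only [ENNReal.toReal_ofNat, Real.rpow_two, Real.norm_eq_abs, sq_abs] at this
    exact this.comp tendsto_levels
  have h3 : Tendsto (fun l => Complex.exp (-((∑ j ∈ levels l, c j ^ 2 : ℝ) : ℂ) * t ^ 2 / 2)) atTop
      (𝓝 (Complex.exp (-((‖c‖ ^ 2 : ℝ) : ℂ) * t ^ 2 / 2))) := by
    refine (Continuous.tendsto (f := fun r : ℝ => Complex.exp (-(r : ℂ) * t ^ 2 / 2))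
      (by fun_prop) _).comp h2
  rw [tendsto_nhds_unique h1 h3, charFun_gaussianReal, Real.coe_toNNReal _ (sq_nonneg _)]
  congr 1
  push_cast
  ring

/-- Sums of independent noise over increasing sets of levels form a martingale. -/
theorem martingale_sum_noise (hmeas : ∀ j, Measurable (ξ j))
    (hlaw : ∀ j, HasLaw (ξ j) (gaussianReal 0 1) P) (hindep : iIndepFun ξ P)
    (c : (Σ κ, HaarIndex κ) → ℝ) :
    Martingale (fun l ω => ∑ j ∈ levels l, c j * ξ j ω) (noiseFiltration ξ hmeas) P := by
  have hle : ∀ j, MeasurableSpace.comap (ξ j) inferInstance ≤ mΩ := fun j => (hmeas j).comap_le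
  have hsm : ∀ (S : Set (Σ κ, HaarIndex κ)) (F : Finset (Σ κ, HaarIndex κ)), (∀ j ∈ F, j ∈ S) →
      StronglyMeasurable[⨆ j ∈ S, MeasurableSpace.comap (ξ j) inferInstance]
        (fun ω => ∑ j ∈ F, c j * ξ j ω) := by
    intro S F hF
    refine Measurable.stronglyMeasurable ?_
    refine Finset.measurable_sum _ fun j hj => Measurable.const_mul ?_ _
    rw [measurable_iff_comap_le]
    exact le_iSup₂_of_le j (hF j hj) le_rfl
  refine martingale_of_condExp_sub_eq_zero_nat
    (fun l => hsm {j | j.1 < l} _ fun j hj => mem_levels.mp hj)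
    (fun l => (memLp_sum_noise hlaw _ c).integrable one_le_two) fun l => ?_
  have hsub : levels l ⊆ levels (l + 1) := fun j hj =>
    mem_levels.mpr ((mem_levels.mp hj).trans (Nat.lt_succ_self l))
  have hdiff : ((fun ω => ∑ j ∈ levels (l + 1), c j * ξ j ω) - fun ω => ∑ j ∈ levels l, c j * ξ j ω)
      = fun ω => ∑ j ∈ levels (l + 1) \ levels l, c j * ξ j ω := by
    funext ω
    rw [Pi.sub_apply, ← Finset.sum_sdiff hsub, add_sub_cancel_right]
  rw [hdiff]
  have hind : Indep
      (⨆ j ∈ {j : Σ κ, HaarIndex κ | l ≤ j.1}, MeasurableSpace.comap (ξ j) inferInstance)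
      (⨆ j ∈ {j : Σ κ, HaarIndex κ | j.1 < l}, MeasurableSpace.comap (ξ j) inferInstance) P :=
    indep_iSup_of_disjoint hle hindep.iIndep
      (Set.disjoint_left.mpr fun _ h1 h2 => absurd (show _ < l from h2) (not_lt_of_ge h1))
  refine (condExp_indep_eq (iSup₂_le fun j _ => hle j) ((noiseFiltration ξ hmeas).le l)
    (hsm _ _ fun j hj => ?_) hind).trans (Eventually.of_forall fun ω => ?_)
  · rw [Finset.mem_sdiff, mem_levels, mem_levels] at hj
    exact not_lt.mp hj.2
  · simp only [Pi.zero_apply]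
    exact integral_sum_noise hlaw _ c

end Noise

/-! ### The biharmonic field -/

theorem sq_sqrt_eight_mul_pi : (Real.sqrt 8 * Real.pi) ^ 2 = 8 * Real.pi ^ 2 := by
  rw [mul_pow, Real.sq_sqrt (by norm_num)]

theorem hasSum_sq_haarCoeff (w : L2T) :
    HasSum (fun j => (Real.sqrt 8 * Real.pi * inner ℝ (haarLp j) w) ^ 2)
      (8 * Real.pi ^ 2 * (‖w‖ ^ 2 - (∫ x, w x) ^ 2)) := by
  simp_rw [mul_pow _ (inner ℝ _ w), sq_sqrt_eight_mul_pi]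
  exact (hasSum_sq_inner_haarLp w).mul_left _

theorem memlp_haarCoeff (w : L2T) :
    Memℓp (fun j => Real.sqrt 8 * Real.pi * inner ℝ (haarLp j) w) 2 := by
  refine memℓp_gen ?_
  convert (hasSum_sq_haarCoeff w).summable using 2 with j
  rw [ENNReal.toReal_ofNat, Real.rpow_two, Real.norm_eq_abs, sq_abs]

/-- The sequence of Haar coefficients `√8 π ⟨η_j, w⟩`. -/
def haarCoeff (w : L2T) : lp (fun _ : Σ κ, HaarIndex κ => ℝ) 2 := ⟨_, memlp_haarCoeff w⟩

theorem haarCoeff_apply (w : L2T) (j : Σ κ, HaarIndex κ) :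
    haarCoeff w j = Real.sqrt 8 * Real.pi * inner ℝ (haarLp j) w := rfl

theorem norm_sq_haarCoeff (w : L2T) :
    ‖haarCoeff w‖ ^ 2 = 8 * Real.pi ^ 2 * (‖w‖ ^ 2 - (∫ x, w x) ^ 2) := by
  have h := lp.hasSum_norm (p := 2) (by simp) (haarCoeff w)
  simp only [ENNReal.toReal_ofNat, Real.rpow_two, Real.norm_eq_abs, sq_abs] at h
  exact h.unique (hasSum_sq_haarCoeff w)

/-- The Haar coefficients, scaled by `√8 π`, as a bounded operator from `L²(𝕋⁴)` to `ℓ²`. -/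
def haarCoeffCLM : L2T →L[ℝ] lp (fun _ : Σ κ, HaarIndex κ => ℝ) 2 :=
  LinearMap.mkContinuous
    { toFun := haarCoeff
      map_add' := fun w w' => lp.ext <| funext fun j => by
        simp only [lp.coeFn_add, Pi.add_apply, haarCoeff_apply, inner_add_right, mul_add]
      map_smul' := fun a w => lp.ext <| funext fun j => by
        simp only [lp.coeFn_smul, Pi.smul_apply, haarCoeff_apply, inner_smul_right, smul_eq_mul,
          RingHom.id_apply]
        ring }
    (Real.sqrt 8 * Real.pi) fun w => by
      refine abs_le_of_sq_le_sq' ?_ (by positivity) |>.2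
      rw [LinearMap.coe_mk, AddHom.coe_mk, norm_sq_haarCoeff, mul_pow, sq_sqrt_eight_mul_pi]
      exact mul_le_mul_of_nonneg_left (by linarith [sq_nonneg (∫ x, w x)]) (by positivity)

/-- The pairing `⟨u, ĥ_ℓ⟩` as a partial sum of a Wiener integral. -/
theorem pairing_hHat {Ω : Type*} (ξ : (Σ κ, HaarIndex κ) → Ω → ℝ) {u : FormalSeries}
    (hu : u ∈ Sobolev (-2)) (l : ℕ) (ω : Ω) :
    pairing u (coeff (hHat ξ l ω)) = ∑ j ∈ levels l, haarCoeff (potential u) j * ξ j ω := by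
  rw [pairing, (hasSum_pairing_hHat ξ l ω hu).tsum_eq]
  exact Finset.sum_congr rfl fun j _ => by rw [haarCoeff_apply]; ring

theorem coeff_hHat_eq {Ω : Type*} (ξ : (Σ κ, HaarIndex κ) → Ω → ℝ) (n : Freq) (l : ℕ) (ω : Ω) :
    coeff (hHat ξ l ω) n =
    ∑ j ∈ levels l, haarCoeff (potential (Pi.single n 1)) j * ξ j ω := by
  rw [coeff_hHat_eq_pairing]
  exact Finset.sum_congr rfl fun j _ => by rw [haarCoeff_apply]; ring

section Field

variable {Ω : Type*} [mΩ : MeasurableSpace Ω] {P : Measure Ω}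
  {ξ : (Σ κ, HaarIndex κ) → Ω → ℝ} (hlaw : ∀ j, HasLaw (ξ j) (gaussianReal 0 1) P)
  (hindep : iIndepFun ξ P)

/-- The Gaussian random variable `√8 π ∑ j, ξ_j ⟨η_j, w⟩`, as an element of `L²(P)` which depends
linearly and continuously on `w ∈ L²(𝕋⁴)`. -/
def whiteNoise : L2T →L[ℝ] Lp ℝ 2 P :=
  (noiseIntegral hlaw hindep).toContinuousLinearMap.comp haarCoeffCLM

theorem whiteNoise_apply (w : L2T) :
    whiteNoise hlaw hindep w = noiseIntegral hlaw hindep (haarCoeff w) := rfl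

theorem norm_sq_whiteNoise {w : L2T} (hw : ∫ x, w x = 0) :
    ‖whiteNoise hlaw hindep w‖ ^ 2 = 8 * Real.pi ^ 2 * ‖w‖ ^ 2 := by
  rw [whiteNoise_apply, LinearIsometry.norm_map, norm_sq_haarCoeff, hw]
  ring

/-- The pairing `⟨u, h⟩ = √8 π ∑ j, ξ_j ⟨η_j, G u⟩` as an element of `L²(P)`. -/
def fieldLp (u : FormalSeries) : Lp ℝ 2 P := whiteNoise hlaw hindep (potential u)

theorem fieldLp_add_smul {u v : FormalSeries} (hu : u ∈ Sobolev (-2)) (hv : v ∈ Sobolev (-2))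
    (a b : ℝ) : fieldLp hlaw hindep (a • u + b • v) =
      a • fieldLp hlaw hindep u + b • fieldLp hlaw hindep v := by
  rw [fieldLp, potential_add_smul hu hv, map_add, map_smul, map_smul]
  rfl

theorem norm_sq_fieldLp {u : FormalSeries} (hu : u ∈ Sobolev (-2)) :
    ‖fieldLp hlaw hindep u‖ ^ 2 = covForm u u := by
  rw [fieldLp, norm_sq_whiteNoise hlaw hindep (integral_potential hu), covForm_eq_inner hu hu,
    real_inner_self_eq_norm_sq]

theorem inner_fieldLp {u v : FormalSeries} (hu : u ∈ Sobolev (-2)) (hv : v ∈ Sobolev (-2)) :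
    inner ℝ (fieldLp hlaw hindep u) (fieldLp hlaw hindep v) = covForm u v := by
  have h := norm_sq_fieldLp hlaw hindep (add_smul_mem_sobolev hu hv 1 1)
  rw [fieldLp_add_smul hlaw hindep hu hv, one_smul, one_smul, norm_add_sq_real,
    norm_sq_fieldLp hlaw hindep hu, norm_sq_fieldLp hlaw hindep hv,
    covForm_eq_inner (add_smul_mem_sobolev hu hv 1 1) (add_smul_mem_sobolev hu hv 1 1),
    potential_add_smul hu hv, one_smul, one_smul, real_inner_self_eq_norm_sq, norm_add_sq_real,
    covForm_eq_inner hu hu, covForm_eq_inner hv hv, real_inner_self_eq_norm_sq,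
    real_inner_self_eq_norm_sq] at h
  rw [covForm_eq_inner hu hv]
  linarith

theorem hasSum_fieldLp {u : FormalSeries} (hu : u ∈ Sobolev (-2)) :
    HasSum (fun n => u n • fieldLp hlaw hindep (Pi.single n 1)) (fieldLp hlaw hindep u) := by
  have := (whiteNoise hlaw hindep).hasSum (hasSum_potential hu)
  simpa only [map_smul, fieldLp] using this

theorem hasLaw_fieldLp [IsProbabilityMeasure P] {u : FormalSeries} (hu : u ∈ Sobolev (-2)) :
    HasLaw (fieldLp hlaw hindep u) (gaussianReal 0 (covForm u u).toNNReal) P := by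
  rw [← norm_sq_fieldLp hlaw hindep hu, fieldLp, whiteNoise_apply, LinearIsometry.norm_map]
  exact hasLaw_noiseIntegral hlaw hindep _

theorem norm_fieldLp_single (n : Freq) :
    ‖fieldLp hlaw hindep (Pi.single n 1)‖ = Real.sqrt 8 * Real.pi * (eigenvalue n)⁻¹ := by
  have h := norm_sq_fieldLp hlaw hindep (single_mem_sobolev (-2) n)
  rw [covForm_single_self, ← sq_sqrt_eight_mul_pi, ← inv_pow, ← mul_pow] at h
  have := eigenvalue_nonneg n
  exact (sq_eq_sq₀ (norm_nonneg _) (by positivity)).mp h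

theorem eLpNorm_sum_fieldLp_sub {u : FormalSeries} (hu : u ∈ Sobolev (-2)) :
    Tendsto (fun F : Finset Freq => eLpNorm (fun ω =>
      (∑ n ∈ F, u n * fieldLp hlaw hindep (Pi.single n 1) ω) - fieldLp hlaw hindep u ω) 2 P)
      atTop (𝓝 0) := by
  have h := (Lp.tendsto_Lp_iff_tendsto_eLpNorm' _ _).mp (hasSum_fieldLp hlaw hindep hu)
  refine h.congr fun F => eLpNorm_congr_ae ?_
  filter_upwards [coeFn_sum_smul_Lp F u fun n => fieldLp hlaw hindep (Pi.single n 1)] with ω hω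
  simp only [Pi.sub_apply, hω]

/-- For `u` of positive regularity the series defining `⟨u, h⟩` converges almost surely, since
`∑ |u_n| / λ_n < ∞` by the Cauchy-Schwarz inequality. -/
theorem fieldLp_ae_eq_pairing {ε : ℝ} (hε : 0 < ε) {u : FormalSeries} (hu : u ∈ Sobolev ε) :
    fieldLp hlaw hindep u =ᵐ[P]
      fun ω => pairing u fun n => fieldLp hlaw hindep (Pi.single n 1) ω := by
  have hu' : u ∈ Sobolev (-2) := sobolev_mono (by linarith) hu
  have hs : Summable fun n => ‖u n • fieldLp hlaw hindep (Pi.single n 1)‖ := by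
    refine Summable.of_nonneg_of_le (fun n => norm_nonneg _) (fun n => ?_)
      (((mem_sobolev_iff.mp hu).add (summable_rpow_mul_inv_eigenvalue_sq hε)).mul_left
        (Real.sqrt 8 * Real.pi))
    rw [norm_smul, norm_fieldLp_single, Real.norm_eq_abs]
    have h1 := Real.rpow_pos_of_pos (one_add_eigenvalue_pos n) (ε / 2)
    have h2 : (1 + eigenvalue n) ^ ε = ((1 + eigenvalue n) ^ (ε / 2)) ^ 2 := by
      rw [← Real.rpow_natCast, ← Real.rpow_mul (one_add_eigenvalue_pos n).le]
      congr 1; push_cast; ring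
    have h3 : |u n| * (eigenvalue n)⁻¹ ≤
        (1 + eigenvalue n) ^ ε * u n ^ 2 + (1 + eigenvalue n) ^ (-ε) * (eigenvalue n ^ 2)⁻¹ := by
      rw [Real.rpow_neg (one_add_eigenvalue_pos n).le, h2]
      set r := (1 + eigenvalue n) ^ (ε / 2)
      have h4 : |u n| * (eigenvalue n)⁻¹ = (r * |u n|) * (r⁻¹ * (eigenvalue n)⁻¹) := by
        field_simp
      have h5 : r ^ 2 * u n ^ 2 + (r ^ 2)⁻¹ * (eigenvalue n ^ 2)⁻¹ =
          (r * |u n|) ^ 2 + (r⁻¹ * (eigenvalue n)⁻¹) ^ 2 := by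
        rw [mul_pow, sq_abs, mul_pow, inv_pow, inv_pow]
      rw [h4, h5]
      nlinarith [sq_nonneg (r * |u n| - r⁻¹ * (eigenvalue n)⁻¹), sq_nonneg (r * |u n|),
        sq_nonneg (r⁻¹ * (eigenvalue n)⁻¹)]
    calc |u n| * (Real.sqrt 8 * Real.pi * (eigenvalue n)⁻¹)
        = (Real.sqrt 8 * Real.pi) * (|u n| * (eigenvalue n)⁻¹) := by ring
      _ ≤ _ := mul_le_mul_of_nonneg_left h3 (by positivity)
  have h1 := Lp.coeFn_tsum (f := fun n => u n • fieldLp hlaw hindep (Pi.single n 1)) 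
    (tsum_enorm_ne_top_iff_summable_norm.mpr hs)
  rw [(hasSum_fieldLp hlaw hindep hu').tsum_eq] at h1
  have h2 : ∀ᵐ ω ∂P, ∀ n, (u n • fieldLp hlaw hindep (Pi.single n 1) : Lp ℝ 2 P) ω =
      u n * fieldLp hlaw hindep (Pi.single n 1) ω :=
    ae_all_iff.mpr fun n => Lp.coeFn_smul _ _
  filter_upwards [h1, h2] with ω hω1 hω2
  rw [hω1]
  exact tsum_congr hω2

theorem lintegral_ofReal_sq {X : Ω → ℝ} (hX : MemLp X 2 P) {a : ℝ} (ha : 0 ≤ a) :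
    ∫⁻ ω, ENNReal.ofReal (a * X ω ^ 2) ∂P = ENNReal.ofReal (a * ∫ ω, X ω ^ 2 ∂P) := by
  rw [← integral_const_mul, ofReal_integral_eq_lintegral_ofReal (hX.integrable_sq.const_mul a)
    (Eventually.of_forall fun ω => by positivity)]

theorem integral_sq_coeFn (f : Lp ℝ 2 P) : ∫ ω, f ω ^ 2 ∂P = ‖f‖ ^ 2 := by
  rw [← real_inner_self_eq_norm_sq, L2.inner_def]
  simp [sq]

/-- For random series with square integrable coefficients, `E ‖Y‖²_{H^s}` is a sum of second
moments. -/
theorem lintegral_sobolevNormSq {Y : Ω → FormalSeries} (hY : ∀ n, MemLp (fun ω => Y ω n) 2 P)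
    (s : ℝ) : ∫⁻ ω, sobolevNormSq s (Y ω) ∂P =
      ∑' n, ENNReal.ofReal ((1 + eigenvalue n) ^ s * ∫ ω, Y ω n ^ 2 ∂P) := by
  unfold sobolevNormSq
  rw [lintegral_tsum fun n => ?_]
  · exact tsum_congr fun n =>
      lintegral_ofReal_sq (hY n) (Real.rpow_nonneg (one_add_eigenvalue_pos n).le _)
  · exact (((hY n).aestronglyMeasurable.aemeasurable.pow_const 2).const_mul _).ennreal_ofReal

theorem integral_sq_fieldLp_single (n : Freq) :
    ∫ ω, fieldLp hlaw hindep (Pi.single n 1) ω ^ 2 ∂P =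
      8 * Real.pi ^ 2 * (eigenvalue n ^ 2)⁻¹ := by
  rw [integral_sq_coeFn, norm_sq_fieldLp hlaw hindep (single_mem_sobolev (-2) n),
    covForm_single_self]

theorem lintegral_sobolevNormSq_field_lt_top {ε : ℝ} (hε : 0 < ε) :
    ∫⁻ ω, sobolevNormSq (-ε) (fun n => fieldLp hlaw hindep (Pi.single n 1) ω) ∂P < ∞ := by
  rw [lintegral_sobolevNormSq fun n => Lp.memLp _]
  simp_rw [integral_sq_fieldLp_single]
  refine Summable.tsum_ofReal_lt_top
    (((summable_rpow_mul_inv_eigenvalue_sq hε).mul_left (8 * Real.pi ^ 2)).congr fun n => ?_)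
  ring

/-- The error of the partial sums is the tail of the series of squared coefficients. -/
theorem integral_sq_sum_noise_sub (c : lp (fun _ : Σ κ, HaarIndex κ => ℝ) 2)
    (F : Finset (Σ κ, HaarIndex κ)) :
    ∫ ω, ((∑ j ∈ F, c j * ξ j ω) - noiseIntegral hlaw hindep c ω) ^ 2 ∂P =
      ‖c‖ ^ 2 - ∑ j ∈ F, c j ^ 2 := by
  have hcoe : (fun ω => ((∑ j ∈ F, c j * ξ j ω) - noiseIntegral hlaw hindep c ω) ^ 2) =ᵐ[P]
      fun ω => ((∑ j ∈ F, c j • noiseLp hlaw j) -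
        noiseIntegral hlaw hindep c : Lp ℝ 2 P) ω ^ 2 := by
    filter_upwards [coeFn_sum_noiseLp hlaw F c,
      Lp.coeFn_sub (∑ j ∈ F, c j • noiseLp hlaw j) (noiseIntegral hlaw hindep c)] with ω h1 h2
    rw [h2, Pi.sub_apply, h1]
  have hon := orthonormal_noiseLp hlaw hindep
  have hinner : ∀ j, inner ℝ (noiseLp hlaw j) (noiseIntegral hlaw hindep c) = c j := fun j => by
    classical
    have h1 := (innerSL ℝ (noiseLp hlaw j)).hasSum (hasSum_noiseIntegral hlaw hindep c)
    refine h1.unique ((hasSum_ite_eq j (c j)).congr_fun fun i => ?_)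
    rw [innerSL_apply_apply, inner_smul_right, orthonormal_iff_ite.mp hon]
    by_cases h : i = j
    · subst h; simp
    · simp [h, Ne.symm h]
  rw [integral_congr_ae hcoe, integral_sq_coeFn, norm_sub_sq_real, LinearIsometry.norm_map,
    sum_inner]
  simp_rw [inner_smul_left, hinner]
  rw [← real_inner_self_eq_norm_sq, hon.inner_sum]
  simp only [conj_trivial, ← sq]
  ring

theorem integral_sq_sum_noise_sub_le (c : lp (fun _ : Σ κ, HaarIndex κ => ℝ) 2)
    (F : Finset (Σ κ, HaarIndex κ)) :
    ∫ ω, ((∑ j ∈ F, c j * ξ j ω) - noiseIntegral hlaw hindep c ω) ^ 2 ∂P ≤ ‖c‖ ^ 2 := by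
  rw [integral_sq_sum_noise_sub]
  linarith [Finset.sum_nonneg fun j (_ : j ∈ F) => sq_nonneg (c j)]

theorem tendsto_integral_sq_sum_noise_sub (c : lp (fun _ : Σ κ, HaarIndex κ => ℝ) 2) :
    Tendsto (fun l => ∫ ω, ((∑ j ∈ levels l, c j * ξ j ω) - noiseIntegral hlaw hindep c ω) ^ 2 ∂P)
      atTop (𝓝 0) := by
  simp_rw [integral_sq_sum_noise_sub]
  have := lp.hasSum_norm (p := 2) (by simp) c
  simp only [ENNReal.toReal_ofNat, Real.rpow_two, Real.norm_eq_abs, sq_abs] at this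
  have h := (this.comp tendsto_levels).const_sub (‖c‖ ^ 2)
  rwa [sub_self] at h

/-- Convergence in `L²(P; H^{-ε})`, by dominated convergence for the sum over the frequencies. -/
theorem tendsto_lintegral_sobolevNormSq_hHat_sub {ε : ℝ} (hε : 0 < ε) :
    Tendsto (fun l => ∫⁻ ω, sobolevNormSq (-ε) (coeff (hHat ξ l ω) -
      fun n => fieldLp hlaw hindep (Pi.single n 1) ω) ∂P) atTop (𝓝 0) := by
  have hmem : ∀ l n, MemLp (fun ω => (coeff (hHat ξ l ω) -
      fun n => fieldLp hlaw hindep (Pi.single n 1) ω) n) 2 P := fun l n => by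
    simp only [Pi.sub_apply, coeff_hHat_eq]
    exact (memLp_sum_noise hlaw _ _).sub (Lp.memLp _)
  simp_rw [lintegral_sobolevNormSq (hmem _)]
  simp only [Pi.sub_apply, coeff_hHat_eq, fieldLp, whiteNoise_apply]
  have hnorm : ∀ n, ‖haarCoeff (potential (Pi.single n 1))‖ ^ 2 =
      8 * Real.pi ^ 2 * (eigenvalue n ^ 2)⁻¹ := fun n => by
    rw [← covForm_single_self, ← norm_sq_fieldLp hlaw hindep (single_mem_sobolev (-2) n), fieldLp,
      whiteNoise_apply, LinearIsometry.norm_map]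
  have hw : ∀ n, 0 ≤ (1 + eigenvalue n) ^ (-ε) := fun n =>
    Real.rpow_nonneg (one_add_eigenvalue_pos n).le _
  have hsum : Summable fun n : Freq =>
      (1 + eigenvalue n) ^ (-ε) * (8 * Real.pi ^ 2 * (eigenvalue n ^ 2)⁻¹) :=
    ((summable_rpow_mul_inv_eigenvalue_sq hε).mul_left (8 * Real.pi ^ 2)).congr fun n => by ring
  have h := tendsto_tsum_of_dominated_convergence (𝓕 := atTop)
    (f := fun l (n : Freq) => (1 + eigenvalue n) ^ (-ε) *
      ∫ ω, ((∑ j ∈ levels l, haarCoeff (potential (Pi.single n 1)) j * ξ j ω) -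
        noiseIntegral hlaw hindep (haarCoeff (potential (Pi.single n 1))) ω) ^ 2 ∂P)
    (g := fun _ => 0) hsum
    (fun n => by
      simpa using (tendsto_integral_sq_sum_noise_sub hlaw hindep
        (haarCoeff (potential (Pi.single n 1)))).const_mul ((1 + eigenvalue n) ^ (-ε)))
    (Eventually.of_forall fun l n => by
      rw [Real.norm_of_nonneg (mul_nonneg (hw n) (integral_nonneg fun _ => sq_nonneg _)), ← hnorm]
      exact mul_le_mul_of_nonneg_left (integral_sq_sum_noise_sub_le hlaw hindep _ _) (hw n))
  rw [tsum_zero] at h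
  have h' := ENNReal.tendsto_ofReal h
  rw [ENNReal.ofReal_zero] at h'
  refine h'.congr fun l => ?_
  refine ENNReal.ofReal_tsum_of_nonneg
    (fun n => mul_nonneg (hw n) (integral_nonneg fun _ => sq_nonneg _))
    (Summable.of_nonneg_of_le
      (fun n => mul_nonneg (hw n) (integral_nonneg fun _ => sq_nonneg _)) (fun n => ?_) hsum)
  rw [← hnorm]
  exact mul_le_mul_of_nonneg_left (integral_sq_sum_noise_sub_le hlaw hindep _ _) (hw n)

theorem ae_mem_sobolev_field : ∀ᵐ ω ∂P, ∀ ε : ℝ, 0 < ε →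
    (fun n => fieldLp hlaw hindep (Pi.single n 1) ω) ∈ Sobolev (-ε) := by
  have h : ∀ᵐ ω ∂P, ∀ k : ℕ,
      (fun n => fieldLp hlaw hindep (Pi.single n 1) ω) ∈ Sobolev (-(1 / ((k : ℝ) + 1))) := by
    refine ae_all_iff.mpr fun k => ?_
    refine ae_lt_top' ?_ (lintegral_sobolevNormSq_field_lt_top hlaw hindep (by positivity)).ne
    unfold sobolevNormSq
    refine AEMeasurable.tsum fun n => ?_
    exact (((Lp.aestronglyMeasurable _).aemeasurable.pow_const 2).const_mul _).ennreal_ofReal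
  filter_upwards [h] with ω hω ε hε
  obtain ⟨k, hk⟩ := exists_nat_one_div_lt hε
  exact sobolev_mono (by linarith) (hω k)

theorem tendsto_eLpNorm_pairing_hHat_sub {u : FormalSeries} (hu : u ∈ Sobolev (-2)) :
    Tendsto (fun l => eLpNorm (fun ω => pairing u (coeff (hHat ξ l ω)) -
      fieldLp hlaw hindep u ω) 2 P) atTop (𝓝 0) := by
  simp_rw [pairing_hHat ξ hu]
  exact tendsto_eLpNorm_sum_noise_sub hlaw hindep _

theorem eLpNorm_pairing_hHat_le (hlaw : ∀ j, HasLaw (ξ j) (gaussianReal 0 1) P)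
    (hindep : iIndepFun ξ P) {u : FormalSeries} (hu : u ∈ Sobolev (-2)) :
    ∃ C : ℝ≥0, ∀ l, eLpNorm (fun ω => pairing u (coeff (hHat ξ l ω))) 2 P ≤ C := by
  simp_rw [pairing_hHat ξ hu]
  set c := haarCoeff (potential u)
  refine ⟨‖c‖₊ + ‖c‖₊, fun l => ?_⟩
  have hX : MemLp (noiseIntegral hlaw hindep c) 2 P := Lp.memLp _
  have hS := memLp_sum_noise hlaw (levels l) c
  have hd : MemLp (fun ω => (∑ j ∈ levels l, c j * ξ j ω) - noiseIntegral hlaw hindep c ω) 2 P :=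
    hS.sub hX
  have hc : ENNReal.ofReal ‖c‖ = ‖c‖₊ := by rw [ofReal_norm]; rfl
  calc eLpNorm (fun ω => ∑ j ∈ levels l, c j * ξ j ω) 2 P
      = eLpNorm ((fun ω => (∑ j ∈ levels l, c j * ξ j ω) - noiseIntegral hlaw hindep c ω) +
          ⇑(noiseIntegral hlaw hindep c)) 2 P := by
        congr 1; funext ω; simp
    _ ≤ _ := eLpNorm_add_le hd.aestronglyMeasurable hX.aestronglyMeasurable one_le_two
    _ ≤ ENNReal.ofReal ‖c‖ + ENNReal.ofReal ‖c‖ := by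
        refine add_le_add ?_ ?_
        · rw [eLpNorm_two_eq hd]
          refine ENNReal.ofReal_le_ofReal (Real.sqrt_le_iff.mpr ⟨norm_nonneg _, ?_⟩)
          exact integral_sq_sum_noise_sub_le hlaw hindep c _
        · rw [eLpNorm_two_eq hX, integral_sq_coeFn, LinearIsometry.norm_map,
            Real.sqrt_sq (norm_nonneg _)]
    _ = _ := by rw [hc]; push_cast; rfl

end Field

end BiharmonicTorus

end

theorem theorem8 {Ω : Type*} [mΩ : MeasurableSpace Ω] (P : Measure Ω) [IsProbabilityMeasure P]
    (ξ : (Σ κ : ℕ, BiharmonicTorus.HaarIndex κ) → Ω → ℝ)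
    (hmeas : ∀ i, Measurable (ξ i))
    (hlaw : ∀ i, HasLaw (ξ i) (gaussianReal 0 1) P)
    (hindep : iIndepFun ξ P) :
    -- every realization of every partial sum is in `H²`, so that it pairs with `H^{-2}`
    (∀ l ω, BiharmonicTorus.coeff (BiharmonicTorus.hHat ξ l ω) ∈ BiharmonicTorus.Sobolev 2) ∧
    -- the random distribution `h`, and the family of random variables `X u = ⟨u, h⟩`
    ∃ (h : Ω → BiharmonicTorus.FormalSeries) (X : BiharmonicTorus.FormalSeries → Ω → ℝ),
      (∀ n, Measurable fun ω => h ω n) ∧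
      (∀ u ∈ BiharmonicTorus.Sobolev (-2), BiharmonicTorus.IsL2Pairing P u h (X u)) ∧
      (∀ ε : ℝ, 0 < ε → ∀ u ∈ BiharmonicTorus.Sobolev ε,
        X u =ᵐ[P] fun ω => BiharmonicTorus.pairing u (h ω)) ∧
      -- `h` is the biharmonic Gaussian field, with covariance function `k`
      BiharmonicTorus.IsBiharmonicField P X ∧
      BiharmonicTorus.HasCovarianceFunction P X BiharmonicTorus.covKernel ∧
      -- the series converges to `h` in `L²(P; H^{-ε})`
      (∀ ε : ℝ, 0 < ε →
        ∫⁻ ω, BiharmonicTorus.sobolevNormSq (-ε) (h ω) ∂P < ∞ ∧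
        Tendsto (fun l => ∫⁻ ω, BiharmonicTorus.sobolevNormSq (-ε)
          (BiharmonicTorus.coeff (BiharmonicTorus.hHat ξ l ω) - h ω) ∂P) atTop (𝓝 0)) ∧
      (∀ᵐ ω ∂P, ∀ ε : ℝ, 0 < ε → h ω ∈ BiharmonicTorus.Sobolev (-ε)) ∧
      -- the pairings with a fixed `u ∈ H^{-2}`
      (∀ u ∈ BiharmonicTorus.Sobolev (-2),
        Martingale
          (fun l ω => BiharmonicTorus.pairing u
            (BiharmonicTorus.coeff (BiharmonicTorus.hHat ξ l ω)))
          (BiharmonicTorus.noiseFiltration ξ hmeas) P ∧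
        (∀ l, ∫ ω, BiharmonicTorus.pairing u
          (BiharmonicTorus.coeff (BiharmonicTorus.hHat ξ l ω)) ∂P = 0) ∧
        (∃ C : ℝ≥0, ∀ l, eLpNorm (fun ω => BiharmonicTorus.pairing u
          (BiharmonicTorus.coeff (BiharmonicTorus.hHat ξ l ω))) 2 P ≤ C) ∧
        Tendsto (fun l => eLpNorm (fun ω => BiharmonicTorus.pairing u
          (BiharmonicTorus.coeff (BiharmonicTorus.hHat ξ l ω)) - X u ω) 2 P) atTop (𝓝 0)) := by
  refine ⟨BiharmonicTorus.coeff_hHat_mem_sobolev ξ,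
    fun ω n => BiharmonicTorus.fieldLp hlaw hindep (Pi.single n 1) ω,
    fun u => BiharmonicTorus.fieldLp hlaw hindep u,
    fun n => (Lp.stronglyMeasurable _).measurable,
    fun u hu => ⟨Lp.memLp _, BiharmonicTorus.eLpNorm_sum_fieldLp_sub hlaw hindep hu⟩,
    fun ε hε u hu => BiharmonicTorus.fieldLp_ae_eq_pairing hlaw hindep hε hu,
    ⟨fun u hu v hv a b => ?_, fun u hu => BiharmonicTorus.hasLaw_fieldLp hlaw hindep hu⟩,
    fun u v hu hv => ⟨BiharmonicTorus.integrable_mul_covKernel_mul hu hv, ?_⟩,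
    fun ε hε => ⟨BiharmonicTorus.lintegral_sobolevNormSq_field_lt_top hlaw hindep hε,
      BiharmonicTorus.tendsto_lintegral_sobolevNormSq_hHat_sub hlaw hindep hε⟩,
    BiharmonicTorus.ae_mem_sobolev_field hlaw hindep,
    fun u hu => ⟨?_, fun l => ?_, BiharmonicTorus.eLpNorm_pairing_hHat_le hlaw hindep hu,
      BiharmonicTorus.tendsto_eLpNorm_pairing_hHat_sub hlaw hindep hu⟩⟩
  · simp only [BiharmonicTorus.fieldLp_add_smul hlaw hindep hu hv]
    filter_upwards [Lp.coeFn_add (a • BiharmonicTorus.fieldLp hlaw hindep u)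
      (b • BiharmonicTorus.fieldLp hlaw hindep v),
      Lp.coeFn_smul a (BiharmonicTorus.fieldLp hlaw hindep u),
      Lp.coeFn_smul b (BiharmonicTorus.fieldLp hlaw hindep v)] with ω h1 h2 h3
    rw [h1, Pi.add_apply, h2, h3]
    rfl
  · rw [BiharmonicTorus.integral_mul_covKernel_mul hu hv, ← BiharmonicTorus.inner_fieldLp hlaw
      hindep (BiharmonicTorus.coeff_mem_sobolev hu (by norm_num))
      (BiharmonicTorus.coeff_mem_sobolev hv (by norm_num)), L2.inner_def]
    simp [mul_comm]
  · simp_rw [BiharmonicTorus.pairing_hHat ξ hu]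
    exact BiharmonicTorus.martingale_sum_noise hmeas hlaw hindep _
  · simp_rw [BiharmonicTorus.pairing_hHat ξ hu]
    exact BiharmonicTorus.integral_sum_noise hlaw _ _
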